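/- **Setting.** Let $\mathscr E$ be a category with pullbacks. A *protocalibration* on $\mathscr E$ is a class of morphisms that contains all isomorphisms, is closed under composition, and is stable under pullback along arbitrary morphisms. A morphism $u:S\to U$ is *powerful* if the pullback functor $\Delta_u:\mathscr E_{/U}\to\mathscr E_{/S}$ has a right adjoint $\Pi_u$. A pair $(\mathscr L,\mathscr R)$ of protocalibrations is *compatible* if every morphism in $\mathscr L$ is powerful and belongs to $\mathscr R$, and $\Pi_u v\in\mathscr R$ whenever $u\in\mathscr L$ and $v\in\mathscr R$. The bicategory ${}_{\mathscr L}\mathrm{Ply}_{\mathscr R}\mathscr E$ has the objects of $\mathscr E$ as objects. A morphism $X\to Y$ is a polynomial $X\xleftarrow{r}A\xrightarrow{n}B\xrightarrow{t}Y$ with $n\in\mathscr L$ and $t\in\mathscr R$. A 2-morphism $(r,n,t)\Rightarrow(r',n',t')$ is a morphism $g:B\to B'$ with $t'g=t$ together with a morphism $\ell:B\times_{B'}A'\to A$ (where the domain is the pullback of $n'$ along $g$) such that $n\ell$ is the projection to $B$ and $r\ell$ is the projection to $A'$ followed by $r'$. Identities are the polynomials all of whose components are identities. The composite of $X\xleftarrow{r}A\xrightarrow{n}B\xrightarrow{t}Y$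 and $Y\xleftarrow{r'}A'\xrightarrow{n'}B'\xrightarrow{t'}W$ is the usual composite of polynomials: $X\leftarrow A''\to M\to W$, where $M\to B'$ is $\Pi_{n'}$ of the pullback of $t$ along $r'$, $N\to M$ is the pullback of $n'$ along $M\to B'$, $A''\to N$ is the pullback of $n$ along the evaluation $N\to B$, and $A''\to M$ is the composite $A''\to N\to M$. For an object $U$, let $\mathbb E_{\mathscr R}U$ be the full subcategory of $\mathscr E_{/U}$ on the objects whose structure morphism is in $\mathscr R$. The category $\mathscr E$ is *$\mathscr R$-extensive* if it has finite coproducts and the comparison functors $$\mathbb E_{\mathscr R}0\to\mathbf 1,\qquad \mathbb E_{\mathscr R}(U+V)\to\mathbb E_{\mathscr R}U\times\mathbb E_{\mathscr R}V,$$ the latter given by pulling back along the coprojections, are equivalences for all $U,V$. A protocalibration $\mathscr W$ is *closed under finite coproducts* in $\mathscr E$ if, for all objects, the morphisms $0\to X$ and the coprojections $X\to X+Y\leftarrow Y$ are in $\mathscr W$, and the copairing $[u,v]:X+Y\to Z$ is in $\mathscr W$ whenever $u:X\to Z$ and $v:Y\to Z$ are in $\mathscr W$. **Theorem.** Let $(\mathscr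 L,\mathscr R)$ be a compatible pair of protocalibrations on an $\mathscr R$-extensive category $\mathscr E$ with pullbacks, such that both $\mathscr L$ and $\mathscr R$ are closed under finite coproducts in $\mathscr E$. Then: 1. The bicategory $\mathscr B={}_{\mathscr L}\mathrm{Ply}_{\mathscr R}\mathscr E$ has finite products in the bicategorical sense ("finite biproducts"): there is an object $T$ such that $\mathscr B(W,T)\simeq\mathbf 1$ for every object $W$; and for all objects $X,Y$ there are an object $P$ and morphisms $\pi_1:P\to X$, $\pi_2:P\to Y$ such that, for every object $W$, composition with $\pi_1$ and $\pi_2$ is an equivalence of categories $\mathscr B(W,P)\to\mathscr B(W,X)\times\mathscr B(W,Y)$. 2. For all objects $X,Y$ the category $\mathscr B(X,Y)$ has finite coproducts, and for every morphism $q:Z\to X$ of $\mathscr B$ the functor $\mathscr B(X,Y)\to\mathscr B(Z,Y)$ that sends $p$ to the composite of $q$ followed by $p$ (composition with $q$ on the diagrammatic left) preserves finite coproducts. -/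

import Mathlib

open CategoryTheory Limits

universe v u w₁ w₂ w₃ w₄ w₅ w₆

set_option linter.unusedSectionVars false
set_option linter.unusedVariables false

namespace PolyBicat

/-- A protocalibration on a category with pullbacks: a class of morphisms containing the
isomorphisms, closed under composition and stable under pullback. (Being stable under base change
and containing identities, `W` contains every isomorphism.) -/
class IsProtocalibration {E : Type u} [Category.{v} E] (W : MorphismProperty E) : Prop extends
    W.IsMultiplicative, W.IsStableUnderBaseChange

section

variable {E : Type u} [Category.{v} E] [HasPullbacks E]

/-- A morphism `f` is powerful (exponentiable) when pulling back along `f` has a right adjoint. -/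
def IsPowerful {S U : E} (f : S ⟶ U) : Prop := (Over.pullback f).IsLeftAdjoint

/-- The right adjoint `Π_f` of pulling back along a powerful morphism. -/
noncomputable def pushforward {S U : E} (f : S ⟶ U) (hf : IsPowerful f) : Over S ⥤ Over U :=
  haveI : (Over.pullback f).IsLeftAdjoint := hf
  (Over.pullback f).rightAdjoint

/-- The adjunction between pulling back along `f` and `Π_f`. -/
noncomputable def pushforwardAdj {S U : E} (f : S ⟶ U) (hf : IsPowerful f) :
    Over.pullback f ⊣ pushforward f hf :=
  haveI : (Over.pullback f).IsLeftAdjoint := hf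
  Adjunction.ofIsLeftAdjoint (Over.pullback f)

/-- The pair `(L, R)` is compatible: every morphism of `L` is powerful and in `R`, and
`Π_f v` is in `R` for all `f` in `L` and `v` in `R`. -/
class IsCompatible (L R : MorphismProperty E) : Prop where
  powerful : ∀ ⦃S U : E⦄ (f : S ⟶ U), L f → IsPowerful f
  le : L ≤ R
  pushforward_mem : ∀ ⦃S U : E⦄ (f : S ⟶ U) (hf : L f) (v : Over S), R v.hom →
    R ((pushforward f (powerful f hf)).obj v).hom

/-- A polynomial `X ⟵r A ⟶n B ⟶t Y` from `X` to `Y` with `n` in `L` and `t` in `R`. -/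
structure Poly (L R : MorphismProperty E) (X Y : E) where
  A : E
  B : E
  r : A ⟶ X
  n : A ⟶ B
  t : B ⟶ Y
  n_mem : L n
  t_mem : R t

variable {L R : MorphismProperty E} {X Y : E}

namespace Poly

section

variable (p : Poly L R X Y) {Z Z' V : E} (b : Z ⟶ p.B)

/-- The chosen pullback of `n : A ⟶ B` along a generalised element `b : Z ⟶ B`. It is the "fibre"
of `n` over `b`. -/
noncomputable def fib : E := pullback b p.n
/-- The projection of the fibre to `Z`. -/
noncomputable def π : p.fib b ⟶ Z := pullback.fst b p.n
/-- The projection of the fibre to `A`. -/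
noncomputable def ι : p.fib b ⟶ p.A := pullback.snd b p.n

lemma π_ι : p.π b ≫ b = p.ι b ≫ p.n := pullback.condition

variable {b}

/-- The universal property of the fibre. -/
noncomputable def lift (x : V ⟶ Z) (a : V ⟶ p.A) (h : x ≫ b = a ≫ p.n) : V ⟶ p.fib b :=
  pullback.lift x a h

@[simp] lemma lift_π (x : V ⟶ Z) (a : V ⟶ p.A) (h : x ≫ b = a ≫ p.n) :
    p.lift x a h ≫ p.π b = x := pullback.lift_fst _ _ _

@[simp] lemma lift_ι (x : V ⟶ Z) (a : V ⟶ p.A) (h : x ≫ b = a ≫ p.n) :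
    p.lift x a h ≫ p.ι b = a := pullback.lift_snd _ _ _

@[simp] lemma lift_π_assoc {V' : E} (x : V ⟶ Z) (a : V ⟶ p.A) (h : x ≫ b = a ≫ p.n)
    (m : Z ⟶ V') : p.lift x a h ≫ p.π b ≫ m = x ≫ m := by rw [← Category.assoc, lift_π]

@[simp] lemma lift_ι_assoc {V' : E} (x : V ⟶ Z) (a : V ⟶ p.A) (h : x ≫ b = a ≫ p.n)
    (m : p.A ⟶ V') : p.lift x a h ≫ p.ι b ≫ m = a ≫ m := by rw [← Category.assoc, lift_ι]

variable {p}

lemma fib_ext {f g : V ⟶ p.fib b} (h₁ : f ≫ p.π b = g ≫ p.π b) (h₂ : f ≫ p.ι b = g ≫ p.ι b) :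
    f = g := pullback.hom_ext h₁ h₂

end

/-- A morphism of polynomials `p ⟶ q`. It consists of `g : p.B ⟶ q.B` over `Y` and a morphism
`l` from the pullback of `q.n` along `g` to `p.A`, over `p.B` and over `X`. These are the isomorphism
classes of diagrams `p.A ⟵ P ⟶ q.A` over `X` together with a pullback square of `P ⟶ q.A` over
`g : p.B ⟶ q.B`; in every class there is exactly one with the chosen pullback `P`. -/
@[ext]
structure Hom (p q : Poly L R X Y) where
  g : p.B ⟶ q.B
  l : q.fib g ⟶ p.A
  g_t : g ≫ q.t = p.t
  l_n : l ≫ p.n = q.π g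
  l_r : l ≫ p.r = q.ι g ≫ q.r

attribute [simp] Hom.g_t Hom.l_n Hom.l_r

/-- The identity morphism of a polynomial. -/
noncomputable abbrev Hom.id (p : Poly L R X Y) : Hom p p where
  g := 𝟙 p.B
  l := p.ι (𝟙 p.B)
  g_t := Category.id_comp _
  l_n := by rw [← π_ι, Category.comp_id]
  l_r := rfl

/-- The composite of two morphisms of polynomials: the pullback of `s.n` along `f.g ≫ h.g`
is mapped to the pullback of `q.n` along `f.g` by pulling back `h.l`, and then to `p.A` by `f.l`. -/
noncomputable abbrev Hom.comp {p q s : Poly L R X Y} (f : Hom p q) (h : Hom q s) : Hom p s where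
  g := f.g ≫ h.g
  l := q.lift (s.π (f.g ≫ h.g))
    (s.lift (s.π (f.g ≫ h.g) ≫ f.g) (s.ι (f.g ≫ h.g))
      (by rw [Category.assoc, π_ι]) ≫ h.l) (by simp) ≫ f.l
  g_t := by simp
  l_n := by simp
  l_r := by simp

/-- The map between fibres induced by a change of generalised elements. -/
noncomputable def fibMap (p : Poly L R X Y) {Z Z' : E} (u : Z' ⟶ Z) {b : Z ⟶ p.B}
    {b' : Z' ⟶ p.B} (h : u ≫ b = b') : p.fib b' ⟶ p.fib b :=
  p.lift (p.π b' ≫ u) (p.ι b') (by rw [Category.assoc, h, π_ι])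

section

variable (p : Poly L R X Y) {Z Z' Z'' V : E} (u : Z' ⟶ Z) {b : Z ⟶ p.B} {b' : Z' ⟶ p.B}
  (h : u ≫ b = b')

@[simp] lemma fibMap_π : p.fibMap u h ≫ p.π b = p.π b' ≫ u := p.lift_π _ _ _

@[simp] lemma fibMap_ι : p.fibMap u h ≫ p.ι b = p.ι b' := p.lift_ι _ _ _

@[simp] lemma fibMap_π_assoc (m : Z ⟶ V) : p.fibMap u h ≫ p.π b ≫ m = p.π b' ≫ u ≫ m := by
  rw [← Category.assoc, fibMap_π, Category.assoc]

@[simp] lemma fibMap_ι_assoc (m : p.A ⟶ V) : p.fibMap u h ≫ p.ι b ≫ m = p.ι b' ≫ m := by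
  rw [← Category.assoc, fibMap_ι]

@[simp] lemma fibMap_id (h : 𝟙 Z ≫ b = b) : p.fibMap (𝟙 Z) h = 𝟙 _ :=
  fib_ext (by simp) (by simp)

lemma fibMap_fibMap {u' : Z'' ⟶ Z'} {b'' : Z'' ⟶ p.B} (h' : u' ≫ b' = b'') :
    p.fibMap u' h' ≫ p.fibMap u h = p.fibMap (u' ≫ u) (by rw [Category.assoc, h, h']) :=
  fib_ext (by simp) (by simp)

lemma fibMap_congr {u v : Z' ⟶ Z} (huv : u = v) (h : u ≫ b = b') (h' : v ≫ b = b') :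
    p.fibMap u h = p.fibMap v h' := by
  subst huv
  rfl

end

end Poly

/-- A presheaf `El` on the category of objects over `X`, together with a restriction-stable
relation between elements over `x : Z ⟶ X` and morphisms out of `Z`. A polynomial from `X` to `Y` acts
on such objects by the usual formula for its extension (`Poly.extFunctor`), and morphisms of polynomials
are the same as natural transformations between the actions (`Poly.extFullyFaithful`). The relation is
carried along so that this holds without any further assumption on the category `E`. This is used only
to organise the whiskerings, associators and unitors of the bicategory of polynomials. -/
structure Test (X : E) where
  El : ∀ {Z : E}, (Z ⟶ X) → Type v
  res : ∀ {Z' Z : E} (u : Z' ⟶ Z) {x : Z ⟶ X} {x' : Z' ⟶ X}, u ≫ x = x' → El x → El x'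
  res_id : ∀ {Z : E} {x : Z ⟶ X} (h : 𝟙 Z ≫ x = x) (e : El x), res (𝟙 Z) h e = e
  res_res : ∀ {Z'' Z' Z : E} (u' : Z'' ⟶ Z') (u : Z' ⟶ Z) {x : Z ⟶ X} {x' : Z' ⟶ X}
    {x'' : Z'' ⟶ X} (h' : u' ≫ x' = x'') (h : u ≫ x = x') (e : El x),
    res u' h' (res u h e) = res (u' ≫ u) (by rw [Category.assoc, h, h']) e
  rel : ∀ {Z W : E} {x : Z ⟶ X}, El x → (Z ⟶ W) → Prop
  rel_res : ∀ {Z' Z W : E} (u : Z' ⟶ Z) {x : Z ⟶ X} {x' : Z' ⟶ X} (h : u ≫ x = x') (e : El x)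
    (m : Z ⟶ W), rel e m → rel (res u h e) (u ≫ m)

namespace Test

lemma res_congr (T : Test X) {Z' Z : E} {u v : Z' ⟶ Z} {x : Z ⟶ X} {x' : Z' ⟶ X}
    (huv : u = v) (h : u ≫ x = x') (e : T.El x) : T.res u h e = T.res v (huv ▸ h) e := by
  subst huv
  rfl

lemma res_eq_self (T : Test X) {Z : E} {u : Z ⟶ Z} {x : Z ⟶ X} (hu : u = 𝟙 Z) (h : u ≫ x = x)
    (e : T.El x) : T.res u h e = e := by
  subst hu
  rw [T.res_id]

lemma rel_res' (T : Test X) {Z' Z V : E} {u : Z' ⟶ Z} {x : Z ⟶ X} {x' : Z' ⟶ X} (h : u ≫ x = x')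
    {e : T.El x} {m : Z ⟶ V} {m' : Z' ⟶ V} (hm : u ≫ m = m') (hr : T.rel e m) :
    T.rel (T.res u h e) m' := by
  subst hm
  exact T.rel_res _ _ _ _ hr

lemma res_square (T : Test X) {Z₁ Z₂ Z₃ Z₄ : E} {a : Z₁ ⟶ Z₂} {b : Z₂ ⟶ Z₄} {c : Z₁ ⟶ Z₃}
    {d : Z₃ ⟶ Z₄} {x : Z₄ ⟶ X} {x₁ : Z₁ ⟶ X} {x₂ : Z₂ ⟶ X} {x₃ : Z₃ ⟶ X} (w : a ≫ b = c ≫ d)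
    (ha : a ≫ x₂ = x₁) (hb : b ≫ x = x₂) (hc : c ≫ x₃ = x₁) (hd : d ≫ x = x₃) (e : T.El x) :
    T.res a ha (T.res b hb e) = T.res c hc (T.res d hd e) := by
  rw [T.res_res, T.res_res, T.res_congr w]

/-- Morphisms of test objects. -/
@[ext]
structure Hom (S T : Test X) where
  app : ∀ {Z : E} (x : Z ⟶ X), S.El x → T.El x
  app_res : ∀ {Z' Z : E} (u : Z' ⟶ Z) {x : Z ⟶ X} {x' : Z' ⟶ X} (h : u ≫ x = x') (e : S.El x),
    app x' (S.res u h e) = T.res u h (app x e)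
  app_rel : ∀ {Z W : E} {x : Z ⟶ X} (e : S.El x) (m : Z ⟶ W), S.rel e m → T.rel (app x e) m

instance : Category (Test X) where
  Hom := Hom
  id S := ⟨fun _ e => e, fun _ _ _ _ _ => rfl, fun _ _ h => h⟩
  comp f g := ⟨fun x e => g.app x (f.app x e), fun u _ _ h e => by rw [f.app_res, g.app_res],
    fun e m h => g.app_rel _ _ (f.app_rel _ _ h)⟩

lemma hom_ext {S T : Test X} {f g : S ⟶ T}
    (h : ∀ {Z : E} (x : Z ⟶ X) (e : S.El x), Hom.app f x e = Hom.app g x e) : f = g := by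
  apply Hom.ext
  funext Z x e
  exact h x e

@[simp] lemma id_app (S : Test X) {Z : E} (x : Z ⟶ X) (e : S.El x) : Hom.app (𝟙 S) x e = e := rfl
@[simp] lemma comp_app {S T U : Test X} (f : S ⟶ T) (g : T ⟶ U) {Z : E} (x : Z ⟶ X) (e : S.El x) :
    Hom.app (f ≫ g) x e = Hom.app g x (Hom.app f x e) := rfl

end Test

namespace Poly

/-- An element over `y : Z ⟶ Y` of the extension of `p` at `T`: a generalised element `b` of `B`
lying over `y`, and an element of `T` labelling the fibre of `n` over `b`, that is, an element over the
composite of `p.fib b ⟶ A` and `r : A ⟶ X`. -/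
structure ExtEl (p : Poly L R X Y) (T : Test X) {Z : E} (y : Z ⟶ Y) : Type v where
  b : Z ⟶ p.B
  b_t : b ≫ p.t = y
  e : T.El (p.ι b ≫ p.r)

lemma extEl_ext (p : Poly L R X Y) (T : Test X) {Z : E} {y : Z ⟶ Y} {s s' : p.ExtEl T y}
    (h : s.b = s'.b)
    (h' : s.e = T.res (p.fibMap (𝟙 _) (by rw [h, Category.id_comp])) (fibMap_ι_assoc _ _ _ _) s'.e) :
    s = s' := by
  obtain ⟨b, hb, e⟩ := s
  obtain ⟨b', hb', e'⟩ := s'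
  obtain rfl : b = b' := h
  rw [T.res_eq_self (p.fibMap_id _)] at h'
  obtain rfl : e = e' := h'
  rfl

lemma extEl_eq (p : Poly L R X Y) (T : Test X) {Z : E} {y : Z ⟶ Y} {s s' : p.ExtEl T y}
    (hs : s = s') : ∃ h : s.b = s'.b,
      s.e = T.res (p.fibMap (𝟙 _) (by rw [h, Category.id_comp])) (fibMap_ι_assoc _ _ _ _) s'.e := by
  subst hs
  refine ⟨rfl, ?_⟩
  rw [T.res_eq_self (p.fibMap_id _)]

/-- Restriction of elements of the extension. -/
noncomputable abbrev ExtEl.res {p : Poly L R X Y} {T : Test X} {Z Z' : E} (u : Z' ⟶ Z) {y : Z ⟶ Y}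
    {y' : Z' ⟶ Y} (h : u ≫ y = y') (s : p.ExtEl T y) : p.ExtEl T y' where
  b := u ≫ s.b
  b_t := by rw [Category.assoc, s.b_t, h]
  e := T.res (p.fibMap u rfl) (fibMap_ι_assoc _ _ _ _) s.e

/-- Functoriality of the extension. -/
noncomputable abbrev ExtEl.map {p : Poly L R X Y} {S T : Test X} (f : S ⟶ T) {Z : E} {y : Z ⟶ Y}
    (s : p.ExtEl S y) : p.ExtEl T y where
  b := s.b
  b_t := s.b_t
  e := f.app _ s.e

/-- The relation on the extension. -/
abbrev ExtEl.Rel {p : Poly L R X Y} {T : Test X} {Z W : E} {y : Z ⟶ Y} (s : p.ExtEl T y)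
    (m : Z ⟶ W) : Prop :=
  T.rel s.e (p.π s.b ≫ m)

lemma ExtEl.map_res {p : Poly L R X Y} {S T : Test X} (f : S ⟶ T) {Z Z' : E} (u : Z' ⟶ Z)
    {y : Z ⟶ Y} {y' : Z' ⟶ Y} (h : u ≫ y = y') (s : p.ExtEl S y) :
    (s.res u h).map f = (s.map f).res u h :=
  p.extEl_ext T rfl (by
    rw [T.res_eq_self (p.fibMap_id _)]
    exact f.app_res _ _ _)

/-- The extension of `p` at `T`. -/
noncomputable abbrev extObj (p : Poly L R X Y) (T : Test X) : Test Y where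
  El y := p.ExtEl T y
  res u _ _ h s := s.res u h
  res_id h s := p.extEl_ext T (Category.id_comp _) (T.res_congr rfl _ _)
  res_res u' u _ _ _ h' h s := p.extEl_ext T (Category.assoc _ _ _).symm
    (T.res_square (fib_ext (by simp) (by simp)) _ _ _ _ _)
  rel s m := s.Rel m
  rel_res u _ _ h s m hm := T.rel_res' _ (fibMap_π_assoc _ _ _ _) hm

/-- The extension of a polynomial as a functor. -/
noncomputable abbrev extFunctor (p : Poly L R X Y) : Test X ⥤ Test Y where
  obj T := p.extObj T
  map f :=
    { app := fun _ s => ExtEl.map f s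
      app_res := fun u _ _ h s => ExtEl.map_res f u h s
      app_rel := fun _ _ h => f.app_rel _ _ h }

section

variable {p q : Poly L R X Y} (f : Hom p q)

/-- The map of fibres given by a morphism of polynomials. -/
noncomputable def Hom.act {Z : E} (b : Z ⟶ p.B) : q.fib (b ≫ f.g) ⟶ p.fib b :=
  p.lift (q.π _) (q.fibMap b rfl ≫ f.l) (by simp)

@[simp] lemma Hom.act_π {Z : E} (b : Z ⟶ p.B) : f.act b ≫ p.π b = q.π (b ≫ f.g) := p.lift_π _ _ _

@[simp] lemma Hom.act_π_assoc {Z V : E} (b : Z ⟶ p.B) (m : Z ⟶ V) :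
    f.act b ≫ p.π b ≫ m = q.π (b ≫ f.g) ≫ m := by rw [← Category.assoc, act_π]

@[simp] lemma Hom.act_ι {Z : E} (b : Z ⟶ p.B) :
    f.act b ≫ p.ι b = q.fibMap b rfl ≫ f.l := p.lift_ι _ _ _

lemma Hom.act_lab {Z : E} (b : Z ⟶ p.B) : f.act b ≫ p.ι b ≫ p.r = q.ι (b ≫ f.g) ≫ q.r := by
  rw [← Category.assoc, f.act_ι, Category.assoc, f.l_r, fibMap_ι_assoc]

lemma Hom.act_fibMap {Z Z' : E} (u : Z' ⟶ Z) (b : Z ⟶ p.B) :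
    f.act (u ≫ b) ≫ p.fibMap u rfl =
      q.fibMap u (Category.assoc u b f.g).symm ≫ f.act b := by
  apply fib_ext
  · simp only [Category.assoc, fibMap_π, act_π, act_π_assoc]
  · simp only [Category.assoc, fibMap_ι, act_ι]
    simp only [← Category.assoc]
    congr 1
    apply fib_ext <;> simp

/-- The action of a morphism of polynomials on elements of the extensions. -/
noncomputable abbrev Hom.actEl {T : Test X} {Z : E} {y : Z ⟶ Y}
    (s : p.ExtEl T y) : q.ExtEl T y where
  b := s.b ≫ f.g
  b_t := by rw [Category.assoc, f.g_t, s.b_t]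
  e := T.res (f.act s.b) (f.act_lab s.b) s.e

lemma Hom.actEl_res {T : Test X} {Z Z' : E} (u : Z' ⟶ Z)
    {y : Z ⟶ Y} {y' : Z' ⟶ Y} (h : u ≫ y = y') (s : p.ExtEl T y) :
    f.actEl (s.res u h) = (f.actEl s).res u h :=
  q.extEl_ext T (Category.assoc _ _ _) (by
    refine (T.res_res _ _ _ _ _).trans (Eq.trans ?_
      ((T.res_res _ _ _ _ _).trans (T.res_res _ _ _ _ _)).symm)
    apply T.res_congr
    rw [f.act_fibMap]
    exact congrArg (· ≫ f.act s.b) (fib_ext (by simp) (by simp)))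

lemma Hom.actEl_map {S T : Test X} (k : S ⟶ T) {Z : E}
    {y : Z ⟶ Y} (s : p.ExtEl S y) : f.actEl (s.map k) = (f.actEl s).map k :=
  q.extEl_ext T rfl (by
    rw [T.res_eq_self (q.fibMap_id _)]
    exact (k.app_res _ _ _).symm)

/-- A morphism of polynomials induces a natural transformation of the extensions. -/
noncomputable abbrev Hom.toNat : p.extFunctor ⟶ q.extFunctor where
  app T :=
    { app := fun _ s => f.actEl s
      app_res := fun u _ _ h s => f.actEl_res u h s
      app_rel := fun s m h => T.rel_res' _ (f.act_π_assoc s.b m) h }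
  naturality S T k := Test.hom_ext fun y s => f.actEl_map k s

end

end Poly

namespace Test

/-- The relation generated by `π`. -/
inductive GenRel {S Z : E} (π : S ⟶ Z) : ∀ {V W : E}, (V ⟶ S) → (V ⟶ W) → Prop
  | mk {V : E} (f : V ⟶ S) : GenRel π f (f ≫ π)

lemma GenRel.res {S Z : E} {π : S ⟶ Z} {V' V W : E} (u : V' ⟶ V) {f : V ⟶ S} {m : V ⟶ W}
    (h : GenRel π f m) : GenRel π (u ≫ f) (u ≫ m) := by
  cases h
  rw [← Category.assoc]
  exact GenRel.mk _

lemma GenRel.eq {S Z : E} {π : S ⟶ Z} {V : E} {f : V ⟶ S} {m : V ⟶ Z}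
    (h : GenRel π f m) : f ≫ π = m := by
  cases h
  rfl

lemma GenRel.of_eq {S Z : E} {π : S ⟶ Z} {V : E} {f : V ⟶ S} {m : V ⟶ Z}
    (h : f ≫ π = m) : GenRel π f m := by
  cases h
  exact GenRel.mk _

/-- The test object represented by `x`, with empty relation. -/
abbrev bare {S : E} (x : S ⟶ X) : Test X where
  El {V} y := {f : V ⟶ S // f ≫ x = y}
  res u _ _ h e := ⟨u ≫ e.1, by rw [Category.assoc, e.2, h]⟩
  res_id _ e := Subtype.ext (Category.id_comp _)
  res_res _ _ _ _ _ _ _ e := Subtype.ext (Category.assoc _ _ _).symm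
  rel _ _ := False
  rel_res _ _ _ _ _ _ h := h

/-- The test object represented by `x`, with the relation generated by `π`. -/
abbrev gen {S Z : E} (x : S ⟶ X) (π : S ⟶ Z) : Test X where
  El {V} y := {f : V ⟶ S // f ≫ x = y}
  res u _ _ h e := ⟨u ≫ e.1, by rw [Category.assoc, e.2, h]⟩
  res_id _ e := Subtype.ext (Category.id_comp _)
  res_res _ _ _ _ _ _ _ e := Subtype.ext (Category.assoc _ _ _).symm
  rel e m := GenRel π e.1 m
  rel_res u _ _ _ _ _ h := h.res u

/-- The comparison of the two representable test objects. -/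
abbrev bareToGen {S Z : E} (x : S ⟶ X) (π : S ⟶ Z) : bare x ⟶ gen x π :=
  Hom.mk (fun _ e => e) (fun _ _ _ _ _ => rfl) (fun _ _ h => h.elim)

/-- Functoriality of `bare`. -/
abbrev bareMap {S S' : E} {x : S ⟶ X} {x' : S' ⟶ X} (k : S ⟶ S') (h : k ≫ x' = x) :
    bare x ⟶ bare x' :=
  Hom.mk (fun _ e => ⟨e.1 ≫ k, by rw [Category.assoc, h, e.2]⟩)
    (fun _ _ _ _ _ => Subtype.ext (Category.assoc _ _ _)) (fun _ _ h => h.elim)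

/-- The Yoneda lemma for `bare`. -/
abbrev bareDesc {S : E} {x : S ⟶ X} (T : Test X) (e : T.El x) : bare x ⟶ T :=
  Hom.mk (fun _ f => T.res f.1 f.2 e) (fun _ _ _ _ _ => (T.res_res _ _ _ _ _).symm)
    (fun _ _ h => h.elim)

end Test

namespace Poly

section

variable {p q : Poly L R X Y} (α : p.extFunctor ⟶ q.extFunctor) {Z : E} (b : Z ⟶ p.B)

/-- The generic element over `b`. -/
noncomputable abbrev bareEl : p.ExtEl (Test.bare (p.ι b ≫ p.r)) (b ≫ p.t) where
  b := b
  b_t := rfl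
  e := ⟨𝟙 _, Category.id_comp _⟩

/-- The image of the generic element under a natural transformation. -/
noncomputable def natEl : q.ExtEl (Test.bare (p.ι b ≫ p.r)) (b ≫ p.t) :=
  Test.Hom.app (α.app _) _ (bareEl b)

lemma natEl_π : (natEl α b).e.1 ≫ p.π b = q.π (natEl α b).b := by
  have hn := congrArg (fun k => (Test.Hom.app k (b ≫ p.t) (bareEl b)))
    (α.naturality (Test.bareToGen (p.ι b ≫ p.r) (p.π b)))
  have h := Test.Hom.app_rel (α.app (Test.gen (p.ι b ≫ p.r) (p.π b))) (x := b ≫ p.t)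
    ⟨b, rfl, ⟨𝟙 _, Category.id_comp _⟩⟩ (𝟙 Z) (Test.GenRel.of_eq (by simp))
  have h2 : (ExtEl.map (Test.bareToGen (p.ι b ≫ p.r) (p.π b)) (natEl α b)).Rel (𝟙 Z) := by
    have : ExtEl.map (Test.bareToGen (p.ι b ≫ p.r) (p.π b)) (natEl α b) = _ := hn.symm
    rw [this]
    exact h
  have := Test.GenRel.eq h2
  rw [Category.comp_id] at this
  exact this

lemma natEl_spec {T : Test X} {y : Z ⟶ Y} (s : p.ExtEl T y) :
    Test.Hom.app (α.app T) y s =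
      ⟨(natEl α s.b).b, (natEl α s.b).b_t.trans s.b_t,
        T.res (natEl α s.b).e.1 (natEl α s.b).e.2 s.e⟩ := by
  obtain ⟨b, rfl, e⟩ := s
  have hn := congrArg (fun k => (Test.Hom.app k (b ≫ p.t) (bareEl b)))
    (α.naturality (Test.bareDesc T e))
  refine Eq.trans ?_ hn
  change _ = Test.Hom.app (α.app T) _ (ExtEl.map (Test.bareDesc T e) (bareEl b))
  congr 1
  change _ = (⟨b, rfl, T.res (𝟙 _) _ e⟩ : p.ExtEl T (b ≫ p.t))
  rw [T.res_id]

lemma natEl_comp {Z' : E} (u : Z' ⟶ Z) : ∃ h : (natEl α (u ≫ b)).b = u ≫ (natEl α b).b,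
    (natEl α (u ≫ b)).e.1 ≫ p.fibMap u rfl = q.fibMap u h.symm ≫ (natEl α b).e.1 := by
  have hn := congrArg (fun k => (Test.Hom.app k ((u ≫ b) ≫ p.t) (bareEl (u ≫ b))))
    (α.naturality (Test.bareMap (p.fibMap u rfl) (fibMap_ι_assoc p u rfl p.r)))
  have h2 := Test.Hom.app_res (α.app (Test.bare (p.ι b ≫ p.r))) u (x' := (u ≫ b) ≫ p.t)
    (Category.assoc _ _ _).symm (bareEl b)
  have h3 : ExtEl.map (Test.bareMap (p.fibMap u rfl) (fibMap_ι_assoc p u rfl p.r))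
      (natEl α (u ≫ b)) = (natEl α b).res u (Category.assoc _ _ _).symm := by
    refine hn.symm.trans (Eq.trans ?_ h2)
    change Test.Hom.app (α.app _) _ _ = _
    congr 1
    exact p.extEl_ext _ rfl (Subtype.ext (by simp))
  obtain ⟨h4, h5⟩ := q.extEl_eq _ h3
  refine ⟨h4, (congrArg Subtype.val h5).trans ?_⟩
  change q.fibMap _ _ ≫ q.fibMap _ _ ≫ _ = _
  rw [← Category.assoc]
  congr 1
  apply fib_ext <;> simp

/-- The morphism of polynomials given by a natural transformation. -/
noncomputable def ofNat : Hom p q where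
  g := (natEl α (𝟙 p.B)).b
  l := (natEl α (𝟙 p.B)).e.1 ≫ p.ι _
  g_t := (natEl α (𝟙 p.B)).b_t.trans (Category.id_comp _)
  l_n := by rw [Category.assoc, ← π_ι, Category.comp_id, natEl_π]
  l_r := by rw [Category.assoc]; exact (natEl α (𝟙 p.B)).e.2

lemma toNat_ofNat : (ofNat α).toNat = α := by
  refine NatTrans.ext (funext fun T => Test.hom_ext fun y s => ?_)
  refine Eq.trans ?_ (natEl_spec α s).symm
  have key : ∀ {b : _ ⟶ p.B} (hb : b = s.b ≫ 𝟙 p.B), b = s.b → ∃ h : (natEl α b).b = s.b ≫ (natEl α (𝟙 p.B)).b,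
    (natEl α b).e.1 ≫ p.fibMap s.b hb.symm = q.fibMap s.b h.symm ≫ (natEl α (𝟙 p.B)).e.1 := by
    intro b hb _
    subst hb
    exact natEl_comp α (𝟙 p.B) s.b
  obtain ⟨h, h'⟩ := key (Category.comp_id _).symm rfl
  refine q.extEl_ext T h.symm ?_
  refine Eq.trans (T.res_congr ?_ _ _) (T.res_res _ _ _ _ _).symm
  apply fib_ext
  · rw [Hom.act_π, Category.assoc, natEl_π, fibMap_π, Category.comp_id]
  · rw [Hom.act_ι, Category.assoc]
    have h2 : (natEl α s.b).e.1 ≫ p.ι _ = q.fibMap s.b h.symm ≫ (ofNat α).l := by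
      have := congrArg (· ≫ p.ι _) h'
      simp only [Category.assoc, fibMap_ι] at this
      exact this
    exact (congrArg (· ≫ (ofNat α).l) ((q.fibMap_congr (Category.id_comp _).symm _ _).trans
      (q.fibMap_fibMap _ _ _).symm)).trans
      ((Category.assoc _ _ _).trans (congrArg (q.fibMap (𝟙 _) _ ≫ ·) h2.symm))

lemma Hom.ext' {f f' : Hom p q} (h : f.g = f'.g)
    (hl : f.l = q.fibMap (𝟙 _) (by rw [h, Category.id_comp]) ≫ f'.l) : f = f' := by
  obtain ⟨g, l, _, _, _⟩ := f
  obtain ⟨g', l', _, _, _⟩ := f'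
  obtain rfl : g = g' := h
  rw [fibMap_id, Category.id_comp] at hl
  obtain rfl : l = l' := hl
  rfl

lemma ofNat_toNat (f : Hom p q) : ofNat f.toNat = f := by
  refine Hom.ext' (Category.id_comp _) ?_
  change (f.act _ ≫ 𝟙 _) ≫ p.ι _ = _
  rw [Category.comp_id, Hom.act_ι]
  exact congrArg (· ≫ f.l) (q.fibMap_congr rfl _ _)

lemma Hom.toNat_injective {f f' : Hom p q} (h : f.toNat = f'.toNat) : f = f' := by
  rw [← ofNat_toNat f, h, ofNat_toNat]

lemma Hom.act_id {Z : E} (b : Z ⟶ p.B) :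
    (Hom.id p).act b = p.fibMap (𝟙 _) (by rw [Category.id_comp, Category.comp_id]) :=
  fib_ext (by simp) (by simp)

lemma Hom.act_comp {s : Poly L R X Y} (f : Hom p q) (h : Hom q s) {Z : E} (b : Z ⟶ p.B) :
    (Hom.comp f h).act b = s.fibMap (𝟙 _) (by rw [Category.id_comp, Category.assoc]) ≫
      h.act (b ≫ f.g) ≫ f.act b := by
  apply fib_ext
  · simp only [act_π, Category.assoc, fibMap_π, Category.comp_id]
  · simp only [act_ι, Category.assoc]
    simp only [← Category.assoc]
    refine congrArg (· ≫ f.l) (fib_ext ?_ ?_)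
    · simp
    · simp only [Category.assoc, fibMap_ι, lift_ι, act_ι]
      simp only [← Category.assoc]
      exact congrArg (· ≫ h.l) (fib_ext (by simp) (by simp))

lemma Hom.toNat_id (p : Poly L R X Y) : (Hom.id p).toNat = 𝟙 p.extFunctor :=
  NatTrans.ext (funext fun T => Test.hom_ext fun _ s =>
    p.extEl_ext T (Category.comp_id _) (T.res_congr (Hom.act_id _) _ _))

lemma Hom.toNat_comp {s : Poly L R X Y} (f : Hom p q) (h : Hom q s) :
    (Hom.comp f h).toNat = f.toNat ≫ h.toNat :=
  NatTrans.ext (funext fun T => Test.hom_ext fun _ e =>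
    s.extEl_ext T (Category.assoc _ _ _).symm ((T.res_congr (Hom.act_comp f h e.b) _ _).trans
      ((congrArg _ (T.res_res _ _ _ _ _)).trans (T.res_res _ _ _ _ _)).symm))

/-- The hom-category of polynomials from `X` to `Y`. -/
noncomputable instance : Category (Poly L R X Y) where
  Hom := Hom
  id := Hom.id
  comp := Hom.comp
  id_comp f := Hom.toNat_injective (by rw [Hom.toNat_comp, Hom.toNat_id, Category.id_comp])
  comp_id f := Hom.toNat_injective (by rw [Hom.toNat_comp, Hom.toNat_id, Category.comp_id])
  assoc f g h := Hom.toNat_injective (by simp only [Hom.toNat_comp, Category.assoc])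

variable (L R X Y) in
/-- The extension, as a functor on the hom-category. -/
noncomputable def ext : Poly L R X Y ⥤ (Test X ⥤ Test Y) where
  obj p := p.extFunctor
  map f := Hom.toNat f
  map_id p := Hom.toNat_id p
  map_comp f h := Hom.toNat_comp f h

variable (L R X Y) in
/-- Morphisms of polynomials are the same as natural transformations of the extensions. -/
noncomputable def extFullyFaithful : (ext L R X Y).FullyFaithful where
  preimage α := ofNat α
  map_preimage α := toNat_ofNat α
  preimage_map f := ofNat_toNat f

end

end Poly

namespace Poly

section

variable [IsProtocalibration L] [IsProtocalibration R] [IsCompatible L R] {W : E}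
  (p : Poly L R X Y) (q : Poly L R Y W)

/-- The object `Π_{q.n} (q.r)^* p.t` over `q.B`. Its generalised elements over `b` are the morphisms
from the fibre of `q.n` over `b` to `p.B` that lie over `Y` (see `substEv`, `substLift`). -/
noncomputable abbrev subst : Over q.B :=
  (pushforward q.n (IsCompatible.powerful R q.n q.n_mem)).obj
    ((Over.pullback q.r).obj (Over.mk p.t))

/-- The evaluation, from the counit of the adjunction. -/
noncomputable def substEv : q.fib (p.subst q).hom ⟶ p.B :=
  ((pushforwardAdj q.n (IsCompatible.powerful R q.n q.n_mem)).counit.app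
    ((Over.pullback q.r).obj (Over.mk p.t))).left ≫ pullback.fst p.t q.r

lemma substEv_t : p.substEv q ≫ p.t = q.ι (p.subst q).hom ≫ q.r := by
  have h := Over.w ((pushforwardAdj q.n (IsCompatible.powerful R q.n q.n_mem)).counit.app
    ((Over.pullback q.r).obj (Over.mk p.t)))
  exact (Category.assoc _ _ _).trans ((congrArg (_ ≫ ·) pullback.condition).trans
    ((Category.assoc _ _ _).symm.trans (congrArg (· ≫ q.r) h)))

variable {Z : E}

/-- The universal property of `subst`. -/
noncomputable def substLift (b : Z ⟶ q.B) (β : q.fib b ⟶ p.B) (h : β ≫ p.t = q.ι b ≫ q.r) :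
    Z ⟶ (p.subst q).left :=
  ((pushforwardAdj q.n (IsCompatible.powerful R q.n q.n_mem)).homEquiv (Over.mk b)
    ((Over.pullback q.r).obj (Over.mk p.t)) (Over.homMk (pullback.lift β (q.ι b) h)
      (pullback.lift_snd _ _ _))).left

lemma substLift_hom (b : Z ⟶ q.B) (β : q.fib b ⟶ p.B) (h : β ≫ p.t = q.ι b ≫ q.r) :
    p.substLift q b β h ≫ (p.subst q).hom = b :=
  Over.w ((pushforwardAdj q.n (IsCompatible.powerful R q.n q.n_mem)).homEquiv (Over.mk b)
    ((Over.pullback q.r).obj (Over.mk p.t)) (Over.homMk (pullback.lift β (q.ι b) h)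
      (pullback.lift_snd _ _ _)))

lemma fibMap_substEv (b : Z ⟶ q.B) (c : Over.mk b ⟶ p.subst q) :
    q.fibMap c.left (Over.w c) ≫ p.substEv q =
      (((pushforwardAdj q.n (IsCompatible.powerful R q.n q.n_mem)).homEquiv _ _).symm c).left ≫
        pullback.fst p.t q.r := by
  have h := (pushforwardAdj q.n (IsCompatible.powerful R q.n q.n_mem)).homEquiv_counit (g := c)
  exact ((congrArg (fun k => k.left ≫ pullback.fst p.t q.r) h).trans (Category.assoc _ _ _)).symm

lemma substLift_ev (b : Z ⟶ q.B) (β : q.fib b ⟶ p.B) (h : β ≫ p.t = q.ι b ≫ q.r) :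
    q.fibMap (p.substLift q b β h) (p.substLift_hom q b β h) ≫ p.substEv q = β := by
  refine (p.fibMap_substEv q b _).trans ?_
  rw [Equiv.symm_apply_apply]
  exact pullback.lift_fst _ _ _

lemma subst_ext {b : Z ⟶ q.B} {c c' : Z ⟶ (p.subst q).left} (h : c ≫ (p.subst q).hom = b)
    (h' : c' ≫ (p.subst q).hom = b)
    (he : q.fibMap c h ≫ p.substEv q = q.fibMap c' h' ≫ p.substEv q) : c = c' := by
  let k : Over.mk b ⟶ p.subst q := Over.homMk c h
  let k' : Over.mk b ⟶ p.subst q := Over.homMk c' h'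
  suffices k = k' from congrArg (fun f => f.left) this
  apply ((pushforwardAdj q.n (IsCompatible.powerful R q.n q.n_mem)).homEquiv _ _).symm.injective
  apply Over.OverMorphism.ext
  apply pullback.hom_ext
  · exact (p.fibMap_substEv q b k).symm.trans (he.trans (p.fibMap_substEv q b k'))
  · exact (Over.w (((pushforwardAdj q.n _).homEquiv _ _).symm k)).trans
      (Over.w (((pushforwardAdj q.n _).homEquiv _ _).symm k')).symm

/-- The composite of `p` from `X` to `Y` and `q` from `Y` to `W`. With `M = Π_{q.n} (q.r)^* p.t`,
it is `X ⟵ p.A ⟵ A' ⟶ N ⟶ M ⟶ q.B ⟶ W`, where `N` is the pullback of `q.n` along `M ⟶ q.B` and `A'` is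
the pullback of `p.n` along the evaluation `N ⟶ p.B`. -/
noncomputable abbrev comp : Poly L R X W where
  A := p.fib (p.substEv q)
  B := (p.subst q).left
  r := p.ι _ ≫ p.r
  n := p.π _ ≫ q.π _
  t := (p.subst q).hom ≫ q.t
  n_mem := L.comp_mem _ _ (L.pullback_fst _ _ p.n_mem) (L.pullback_fst _ _ q.n_mem)
  t_mem := R.comp_mem _ _ (IsCompatible.pushforward_mem (L := L) _ q.n_mem _ (R.pullback_snd _ _ p.t_mem)) q.t_mem

variable (X) in
/-- The identity polynomial. -/
abbrev idPoly : Poly L R X X where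
  A := X
  B := X
  r := 𝟙 X
  n := 𝟙 X
  t := 𝟙 X
  n_mem := L.id_mem X
  t_mem := R.id_mem X

end

end Poly

namespace Poly

section

variable [IsProtocalibration L] [IsProtocalibration R] [IsCompatible L R] {W : E}
  (p : Poly L R X Y) (q : Poly L R Y W) {Z : E}

/-- A fibre of the composite polynomial is an iterated fibre. -/
noncomputable def unnest (c : Z ⟶ (p.comp q).B) {b : Z ⟶ q.B} (hb : c ≫ (p.subst q).hom = b)
    {β : q.fib b ⟶ p.B} (hβ : q.fibMap c hb ≫ p.substEv q = β) :
    p.fib β ⟶ (p.comp q).fib c :=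
  (p.comp q).lift (p.π β ≫ q.π b) (p.fibMap (q.fibMap c hb) hβ) (by
    rw [fibMap_π_assoc, fibMap_π, Category.assoc])

/-- Auxiliary to `nest`. -/
noncomputable def nestAux (c : Z ⟶ (p.comp q).B) {b : Z ⟶ q.B} (hb : c ≫ (p.subst q).hom = b) :
    (p.comp q).fib c ⟶ q.fib b :=
  q.lift ((p.comp q).π c) ((p.comp q).ι c ≫ p.π _ ≫ q.ι _) (by
    rw [← hb, ← Category.assoc, π_ι]
    simp only [Category.assoc, π_ι])

lemma nestAux_fibMap (c : Z ⟶ (p.comp q).B) {b : Z ⟶ q.B} (hb : c ≫ (p.subst q).hom = b) :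
    nestAux p q c hb ≫ q.fibMap c hb = (p.comp q).ι c ≫ p.π _ := by
  unfold nestAux
  apply fib_ext
  · simp only [Category.assoc, fibMap_π, lift_π_assoc, π_ι]
  · simp only [Category.assoc, fibMap_ι, lift_ι]

/-- A fibre of the composite polynomial is an iterated fibre. -/
noncomputable def nest (c : Z ⟶ (p.comp q).B) {b : Z ⟶ q.B} (hb : c ≫ (p.subst q).hom = b)
    {β : q.fib b ⟶ p.B} (hβ : q.fibMap c hb ≫ p.substEv q = β) :
    (p.comp q).fib c ⟶ p.fib β :=
  p.lift (nestAux p q c hb) ((p.comp q).ι c ≫ p.ι _) (by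
    rw [Category.assoc, ← π_ι, ← hβ, ← Category.assoc, nestAux_fibMap, Category.assoc])

variable {p q} {c : Z ⟶ (p.comp q).B} {b : Z ⟶ q.B} (hb : c ≫ (p.subst q).hom = b)
    {β : q.fib b ⟶ p.B} (hβ : q.fibMap c hb ≫ p.substEv q = β)

@[simp] lemma unnest_π : unnest p q c hb hβ ≫ (p.comp q).π c = p.π β ≫ q.π b := lift_π _ _ _ _
@[simp] lemma unnest_ι : unnest p q c hb hβ ≫ (p.comp q).ι c = p.fibMap (q.fibMap c hb) hβ :=
  lift_ι _ _ _ _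
@[simp] lemma unnest_π_assoc {V : E} (m : Z ⟶ V) :
    unnest p q c hb hβ ≫ (p.comp q).π c ≫ m = p.π β ≫ q.π b ≫ m := by
  rw [← Category.assoc, unnest_π, Category.assoc]
@[simp] lemma nest_π : nest p q c hb hβ ≫ p.π β = nestAux p q c hb := lift_π _ _ _ _
lemma nestAux_π : nestAux p q c hb ≫ q.π b = (p.comp q).π c := lift_π _ _ _ _
lemma nestAux_ι : nestAux p q c hb ≫ q.ι b = (p.comp q).ι c ≫ p.π _ ≫ q.ι _ := lift_ι _ _ _ _
@[simp] lemma nest_ι : nest p q c hb hβ ≫ p.ι β = (p.comp q).ι c ≫ p.ι _ := lift_ι _ _ _ _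

lemma unnest_lab : unnest p q c hb hβ ≫ (p.comp q).ι c ≫ p.ι _ ≫ p.r = p.ι β ≫ p.r := by
  rw [← Category.assoc, unnest_ι, fibMap_ι_assoc]

lemma nest_lab : nest p q c hb hβ ≫ p.ι β ≫ p.r = (p.comp q).ι c ≫ p.ι _ ≫ p.r := by
  rw [← Category.assoc, nest_ι, Category.assoc]

lemma unnest_nest : unnest p q c hb hβ ≫ nest p q c hb hβ = 𝟙 _ := by
  apply fib_ext
  · rw [Category.assoc, nest_π, Category.id_comp]
    apply fib_ext
    · rw [Category.assoc, nestAux_π, unnest_π]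
    · rw [Category.assoc, nestAux_ι, ← Category.assoc, unnest_ι, fibMap_π_assoc, fibMap_ι]
  · rw [Category.assoc, nest_ι, ← Category.assoc, unnest_ι, fibMap_ι, Category.id_comp]

lemma nest_unnest : nest p q c hb hβ ≫ unnest p q c hb hβ = 𝟙 _ := by
  apply fib_ext
  · rw [Category.assoc, unnest_π, ← Category.assoc, nest_π, nestAux_π, Category.id_comp]
  · rw [Category.assoc, unnest_ι, Category.id_comp]
    apply fib_ext
    · rw [Category.assoc, fibMap_π, ← Category.assoc, nest_π, nestAux_fibMap]
    · rw [Category.assoc, fibMap_ι, nest_ι]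

variable {T : Test X} {y : Z ⟶ W}

/-- An element of the extension of the composite is an element of the iterated extension. -/
noncomputable abbrev ExtEl.nest (s : (p.comp q).ExtEl T y) : q.ExtEl (p.extObj T) y where
  b := s.b ≫ (p.subst q).hom
  b_t := by rw [Category.assoc, s.b_t]
  e :=
    { b := q.fibMap s.b rfl ≫ p.substEv q
      b_t := by rw [Category.assoc, substEv_t, fibMap_ι_assoc]
      e := T.res (Poly.unnest p q s.b rfl rfl) (unnest_lab _ _) s.e }

/-- The inverse of `ExtEl.nest`. -/
noncomputable abbrev ExtEl.unnest (s : q.ExtEl (p.extObj T) y) : (p.comp q).ExtEl T y where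
  b := p.substLift q s.b s.e.b s.e.b_t
  b_t := by rw [← Category.assoc, substLift_hom, s.b_t]
  e := T.res (Poly.nest p q _ (p.substLift_hom q _ _ _) (p.substLift_ev q _ _ _))
    (nest_lab _ _) s.e.e

lemma ExtEl.nest_mk (hy : b ≫ q.t = y) (hr : β ≫ p.t = q.ι b ≫ q.r) (hy' : c ≫ (p.comp q).t = y)
    (e : T.El (p.ι β ≫ p.r)) :
    ExtEl.nest (⟨c, hy', T.res (Poly.nest p q c hb hβ) (nest_lab _ _) e⟩ : (p.comp q).ExtEl T y) =
      (⟨b, hy, ⟨β, hr, e⟩⟩ : q.ExtEl (p.extObj T) y) := by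
  subst hb hβ
  have h : T.res (Poly.unnest p q c rfl rfl) (unnest_lab _ _)
      (T.res (Poly.nest p q c rfl rfl) (nest_lab _ _) e) = e :=
    (T.res_res _ _ _ _ _).trans (T.res_eq_self (Poly.unnest_nest _ _) _ _)
  dsimp only [ExtEl.nest]
  congr 2

lemma ExtEl.unnest_nest (s : q.ExtEl (p.extObj T) y) : s.unnest.nest = s :=
  ExtEl.nest_mk _ _ _ _ _ _

lemma ExtEl.nest_unnest (s : (p.comp q).ExtEl T y) : s.nest.unnest = s := by
  obtain ⟨c, hc, e⟩ := s
  have key : ∀ (c' : Z ⟶ (p.comp q).B) (h : c' = c) (hc' : c' ≫ (p.comp q).t = y)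
      (hb' : c' ≫ (p.subst q).hom = c ≫ (p.subst q).hom)
      (hβ' : q.fibMap c' hb' ≫ p.substEv q = q.fibMap c rfl ≫ p.substEv q),
      (⟨c', hc', T.res (Poly.nest p q c' hb' hβ') (nest_lab _ _)
        (T.res (Poly.unnest p q c rfl rfl) (unnest_lab _ _) e)⟩ : (p.comp q).ExtEl T y) =
        ⟨c, hc, e⟩ := by
    intro c' h hc' hb' hβ'
    subst h
    congr 1
    exact (T.res_res _ _ _ _ _).trans (T.res_eq_self (Poly.nest_unnest _ _) _ _)
  exact key _ (p.subst_ext q (p.substLift_hom q _ _ _) rfl (p.substLift_ev q _ _ _)) _ _ _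

lemma ExtEl.nest_res {Z' : E} (u : Z' ⟶ Z) {y' : Z' ⟶ W} (h : u ≫ y = y')
    (s : (p.comp q).ExtEl T y) : (s.res u h).nest = ExtEl.res (T := p.extObj T) u h s.nest := by
  refine q.extEl_ext _ (Category.assoc _ _ _) (p.extEl_ext _ ?_ ?_)
  · simp only [← Category.assoc]
    refine congrArg (· ≫ p.substEv q) (fib_ext ?_ ?_)
    · simp
    · simp
  · refine Eq.trans (T.res_res _ _ _ _ _) (Eq.trans (T.res_congr ?_ _ _)
      ((congrArg _ ((congrArg _ (T.res_res _ _ _ _ _)).trans (T.res_res _ _ _ _ _))).trans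
        (T.res_res _ _ _ _ _)).symm)
    apply fib_ext
    · simp
    · simp only [Category.assoc, unnest_ι, fibMap_ι, fibMap_fibMap]
      exact fibMap_congr _ (fib_ext (by simp) (by simp)) _ _

lemma ExtEl.nest_map {S T : Test X} (k : S ⟶ T) (s : (p.comp q).ExtEl S y) :
    (s.map k).nest = s.nest.map (p.extFunctor.map k) := by
  dsimp only [ExtEl.nest, ExtEl.map]
  congr 2
  exact (k.app_res _ _ _).symm

variable (p q) in
/-- The extension of the composite polynomial is the composite of the extensions. -/
noncomputable def extComp : (p.comp q).extFunctor ≅ p.extFunctor ⋙ q.extFunctor :=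
  NatIso.ofComponents (fun T =>
    { hom :=
        { app := fun _ s => ExtEl.nest s
          app_res := fun u _ _ h s => ExtEl.nest_res u h s
          app_rel := fun s m h => T.rel_res' _ (unnest_π_assoc _ _ _) h }
      inv :=
        { app := fun _ s => ExtEl.unnest s
          app_res := fun u _ _ h s => by
            have := ExtEl.nest_res u h (ExtEl.unnest s)
            rw [ExtEl.unnest_nest] at this
            exact (congrArg ExtEl.unnest this.symm).trans (ExtEl.nest_unnest _)
          app_rel := fun s m h => T.rel_res' _ (by
            rw [← Category.assoc, nest_π, ← Category.assoc, nestAux_π]) h }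
      hom_inv_id := Test.hom_ext fun _ s => ExtEl.nest_unnest s
      inv_hom_id := Test.hom_ext fun _ s => ExtEl.unnest_nest s })
    (fun k => Test.hom_ext fun _ s => ExtEl.nest_map k s)

end

section

variable [IsProtocalibration L] [IsProtocalibration R] (T : Test X) {Z : E} {y : Z ⟶ X}

/-- The section of the (invertible) projection of a fibre of the identity polynomial. -/
noncomputable abbrev idFib (b : Z ⟶ (idPoly X : Poly L R X X).B) : Z ⟶ (idPoly X : Poly L R X X).fib b :=
  Poly.lift _ (𝟙 Z) b (by rw [Category.id_comp, Category.comp_id])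

lemma idFib_lab (b : Z ⟶ (idPoly X : Poly L R X X).B) (h : b ≫ 𝟙 X = y) :
    idFib b ≫ (idPoly X : Poly L R X X).ι b ≫ (idPoly X : Poly L R X X).r = y := by
  rw [← Category.assoc, lift_ι, h]

variable (L R X) in
/-- The extension of the identity polynomial is the identity. -/
noncomputable def extId : (idPoly X : Poly L R X X).extFunctor ≅ 𝟭 (Test X) :=
  NatIso.ofComponents (fun T =>
    { hom :=
        { app := fun _ s => T.res (idFib s.b) (idFib_lab _ s.b_t) s.e
          app_res := fun u _ _ h s => T.res_square (by
            apply fib_ext <;> simp [idFib]) _ _ _ _ _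
          app_rel := fun s m h => T.rel_res' _ (by
            rw [lift_π_assoc, Category.id_comp]) h }
      inv :=
        { app := fun y e => ⟨y, Category.comp_id _, T.res (Poly.π _ _) (π_ι _ _) e⟩
          app_res := fun u _ _ h s => extEl_ext _ _ h.symm ((T.res_res _ _ _ _ _).trans (Eq.symm
            ((congrArg _ (T.res_res _ _ _ _ _)).trans ((T.res_res _ _ _ _ _).trans
            (T.res_congr (by simp) _ _)))))
          app_rel := fun s m h => T.rel_res _ _ _ _ h }
      hom_inv_id := Test.hom_ext fun _ s => by
        obtain ⟨b, rfl, e⟩ := s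
        refine extEl_ext _ _ (Category.comp_id _) ((T.res_res _ _ _ _ _).trans (T.res_congr ?_ _ _))
        apply fib_ext
        · simp
        · simp only [Category.assoc, lift_ι]
          exact (congrArg (_ ≫ ·) (Category.comp_id b).symm).trans
            ((Poly.π_ι (idPoly X : Poly L R X X) (b ≫ 𝟙 X)).trans
              ((Category.comp_id _).trans (fibMap_ι _ _ _).symm))
      inv_hom_id := Test.hom_ext fun _ s => (T.res_res _ _ _ _ _).trans
        (T.res_eq_self (Poly.lift_π _ _ _ _) _ _) })
    (fun k => Test.hom_ext fun _ s => (k.app_res _ _ _).symm)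

end

end Poly

end
lemma map_eq {C : Type w₁} [Category.{w₂} C] {D : Type w₃} [Category.{w₄} D] {G G' : C ⥤ D}
    (α : G ≅ G') {A A' : C} (k : A ⟶ A') : G.map k = α.hom.app A ≫ G'.map k ≫ α.inv.app A' := by
  simp

lemma map_hom_inv_assoc {C : Type w₁} [Category.{w₂} C] {D : Type w₃} [Category.{w₄} D]
    {G G' : C ⥤ D} (α : G ≅ G') {A : C} {C' : Type w₅} [Category.{w₆} C'] (K : D ⥤ C') {Q : C'}
    (k : K.obj (G.obj A) ⟶ Q) :
    K.map (α.hom.app A) ≫ K.map (α.inv.app A) ≫ k = k := by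
  rw [← K.map_comp_assoc, Iso.hom_inv_id_app, K.map_id, Category.id_comp]

/-- Categories `H X Y` with identities and a composition on objects, represented fully faithfully
by functors `T X ⥤ T Y` in such a way that identities and composition become those of functors up to
natural isomorphism. Then there is exactly one bicategory structure for which the representation
is a (locally fully faithful) pseudofunctor with these constraints. -/
structure FunctorRep (B : Type w₁) (H : B → B → Type w₂) [∀ X Y, Category.{w₃} (H X Y)]
    (T : B → Type w₄) [∀ X, Category.{w₅} (T X)] where
  F : ∀ X Y, H X Y ⥤ (T X ⥤ T Y)
  ff : ∀ X Y, (F X Y).FullyFaithful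
  one : ∀ X, H X X
  comp : ∀ {X Y Z}, H X Y → H Y Z → H X Z
  oneIso : ∀ X, (F X X).obj (one X) ≅ 𝟭 (T X)
  compIso : ∀ {X Y Z} (p : H X Y) (q : H Y Z),
    (F X Z).obj (comp p q) ≅ (F X Y).obj p ⋙ (F Y Z).obj q

namespace FunctorRep

variable {B : Type w₁} {H : B → B → Type w₂} [∀ X Y, Category.{w₃} (H X Y)]
    {T : B → Type w₄} [∀ X, Category.{w₅} (T X)] (r : FunctorRep B H T) {X Y Z W : B}

/-- Left whiskering. -/
def whiskerL (p : H X Y) {q q' : H Y Z} (h : q ⟶ q') : r.comp p q ⟶ r.comp p q' :=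
  (r.ff X Z).preimage ((r.compIso p q).hom ≫
    Functor.whiskerLeft ((r.F X Y).obj p) ((r.F Y Z).map h) ≫ (r.compIso p q').inv)

/-- Right whiskering. -/
def whiskerR {p p' : H X Y} (f : p ⟶ p') (q : H Y Z) : r.comp p q ⟶ r.comp p' q :=
  (r.ff X Z).preimage ((r.compIso p q).hom ≫
    Functor.whiskerRight ((r.F X Y).map f) ((r.F Y Z).obj q) ≫ (r.compIso p' q).inv)

/-- The associator. -/
def assoc (p : H X Y) (q : H Y Z) (s : H Z W) :
    r.comp (r.comp p q) s ≅ r.comp p (r.comp q s) :=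
  (r.ff X W).preimageIso
    (r.compIso (r.comp p q) s ≪≫ Functor.isoWhiskerRight (r.compIso p q) ((r.F Z W).obj s) ≪≫
      Functor.associator _ _ _ ≪≫
      (Functor.isoWhiskerLeft ((r.F X Y).obj p) (r.compIso q s)).symm ≪≫
      (r.compIso p (r.comp q s)).symm)

/-- The left unitor. -/
def leftUnit (p : H X Y) : r.comp (r.one X) p ≅ p :=
  (r.ff X Y).preimageIso (r.compIso (r.one X) p ≪≫
    Functor.isoWhiskerRight (r.oneIso X) ((r.F X Y).obj p) ≪≫ Functor.leftUnitor _)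

/-- The right unitor. -/
def rightUnit (p : H X Y) : r.comp p (r.one Y) ≅ p :=
  (r.ff X Y).preimageIso (r.compIso p (r.one Y) ≪≫
    Functor.isoWhiskerLeft ((r.F X Y).obj p) (r.oneIso Y) ≪≫ Functor.rightUnitor _)

lemma hom_ext {p q : H X Y} {f g : p ⟶ q}
    (h : ∀ A, ((r.F X Y).map f).app A = ((r.F X Y).map g).app A) : f = g :=
  (r.ff X Y).map_injective (NatTrans.ext (funext h))

section
variable (A : T X)

lemma whiskerL_app (p : H X Y) {q q' : H Y Z} (h : q ⟶ q') :
    ((r.F X Z).map (r.whiskerL p h)).app A = (r.compIso p q).hom.app A ≫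
      ((r.F Y Z).map h).app (((r.F X Y).obj p).obj A) ≫ (r.compIso p q').inv.app A := by
  simp [whiskerL]

lemma whiskerR_app {p p' : H X Y} (f : p ⟶ p') (q : H Y Z) :
    ((r.F X Z).map (r.whiskerR f q)).app A = (r.compIso p q).hom.app A ≫
      ((r.F Y Z).obj q).map (((r.F X Y).map f).app A) ≫ (r.compIso p' q).inv.app A := by
  simp [whiskerR]

lemma assoc_hom_app (p : H X Y) (q : H Y Z) (s : H Z W) :
    ((r.F X W).map (r.assoc p q s).hom).app A = (r.compIso (r.comp p q) s).hom.app A ≫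
      ((r.F Z W).obj s).map ((r.compIso p q).hom.app A) ≫
      (r.compIso q s).inv.app (((r.F X Y).obj p).obj A) ≫
      (r.compIso p (r.comp q s)).inv.app A := by
  simp [assoc]

lemma assoc_inv_app (p : H X Y) (q : H Y Z) (s : H Z W) :
    ((r.F X W).map (r.assoc p q s).inv).app A = (r.compIso p (r.comp q s)).hom.app A ≫
      (r.compIso q s).hom.app (((r.F X Y).obj p).obj A) ≫
      ((r.F Z W).obj s).map ((r.compIso p q).inv.app A) ≫
      (r.compIso (r.comp p q) s).inv.app A := by
  simp [assoc]

lemma leftUnit_hom_app (p : H X Y) :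
    ((r.F X Y).map (r.leftUnit p).hom).app A = (r.compIso (r.one X) p).hom.app A ≫
      ((r.F X Y).obj p).map ((r.oneIso X).hom.app A) := by
  simp [leftUnit]

lemma leftUnit_inv_app (p : H X Y) :
    ((r.F X Y).map (r.leftUnit p).inv).app A =
      ((r.F X Y).obj p).map ((r.oneIso X).inv.app A) ≫ (r.compIso (r.one X) p).inv.app A := by
  simp [leftUnit]

lemma rightUnit_hom_app (p : H X Y) :
    ((r.F X Y).map (r.rightUnit p).hom).app A = (r.compIso p (r.one Y)).hom.app A ≫
      (r.oneIso Y).hom.app (((r.F X Y).obj p).obj A) := by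
  simp [rightUnit]

lemma rightUnit_inv_app (p : H X Y) :
    ((r.F X Y).map (r.rightUnit p).inv).app A =
      (r.oneIso Y).inv.app (((r.F X Y).obj p).obj A) ≫ (r.compIso p (r.one Y)).inv.app A := by
  simp [rightUnit]

end

attribute [local simp] whiskerL_app whiskerR_app assoc_hom_app assoc_inv_app leftUnit_hom_app
  rightUnit_hom_app leftUnit_inv_app rightUnit_inv_app

/-- The bicategory given by a representation by functors. -/
@[reducible]
def bicategory : Bicategory B where
  Hom X Y := H X Y
  id X := r.one X
  comp p q := r.comp p q
  homCategory X Y := inferInstanceAs (Category (H X Y))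
  whiskerLeft p _ _ h := r.whiskerL p h
  whiskerRight f q := r.whiskerR f q
  associator p q s := r.assoc p q s
  leftUnitor p := r.leftUnit p
  rightUnitor p := r.rightUnit p
  whiskerLeft_id p q := r.hom_ext fun A => by simp
  whiskerLeft_comp p _ _ _ f g := r.hom_ext fun A => by simp
  id_whiskerLeft f := r.hom_ext fun A => by
    simp only [whiskerL_app, leftUnit_hom_app, leftUnit_inv_app, Functor.map_comp,
      NatTrans.comp_app, Category.assoc]
    simp only [← NatTrans.naturality_assoc, map_hom_inv_assoc, Functor.id_obj]
  comp_whiskerLeft p q _ _ f := r.hom_ext fun A => by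
    simp only [whiskerL_app, assoc_hom_app, assoc_inv_app, Functor.map_comp, Functor.comp_obj,
      NatTrans.comp_app, Category.assoc, Iso.inv_hom_id_app_assoc]
    simp only [NatTrans.naturality_assoc, map_hom_inv_assoc]
  id_whiskerRight p q := r.hom_ext fun A => by simp
  comp_whiskerRight f g q := r.hom_ext fun A => by simp
  whiskerRight_id f := r.hom_ext fun A => by
    simp [map_eq (r.oneIso _)]
  whiskerRight_comp f p q := r.hom_ext fun A => by
    simp [map_eq (r.compIso p q)]
  whisker_assoc p _ _ f q := r.hom_ext fun A => by simp
  whisker_exchange f g := r.hom_ext fun A => by simp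
  pentagon p q s t := r.hom_ext fun A => by
    simp [map_eq (r.compIso s t)]
  triangle p q := r.hom_ext fun A => by simp

end FunctorRep

/-- The objects of the bicategory of polynomials: a copy of the objects of `E`, tagged with the
classes of morphisms `L` and `R`. -/
structure Ply {E : Type u} [Category.{v} E] (L R : MorphismProperty E) : Type u where
  /-- The underlying object. -/
  obj : E

section

variable {E : Type u} [Category.{v} E] [HasPullbacks E] (L R : MorphismProperty E)
  [IsProtocalibration L] [IsProtocalibration R] [IsCompatible L R]

/-- The representation of polynomials by their extensions. -/
noncomputable def plyRep :
    FunctorRep (Ply L R) (fun X Y => Poly L R X.obj Y.obj) (fun X => Test X.obj) where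
  F X Y := Poly.ext L R X.obj Y.obj
  ff X Y := Poly.extFullyFaithful L R X.obj Y.obj
  one X := Poly.idPoly X.obj
  comp p q := Poly.comp p q
  oneIso X := Poly.extId L R X.obj
  compIso p q := Poly.extComp p q

/-- The bicategory of polynomials: its objects are those of `E`, its hom-categories are the
categories `Poly L R X Y`, its identities are `Poly.idPoly`, and composition of 1-cells is `Poly.comp`.
The composition of 2-cells, the associators and the unitors are those that act on generalised elements
in the evident way. -/
noncomputable instance : Bicategory (Ply L R) := (plyRep L R).bicategory

end

/-- The wide subcategory `W` is closed under finite coproducts: it contains the morphisms out of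
the initial object and the coprojections, and the copairing of two morphisms of `W` is in `W`. -/
structure ClosedUnderFiniteCoproducts {E : Type u} [Category.{v} E] [HasFiniteCoproducts E]
    (W : MorphismProperty E) : Prop where
  initial_to : ∀ X : E, W (initial.to X)
  inl : ∀ X Y : E, W (coprod.inl : X ⟶ X ⨿ Y)
  inr : ∀ X Y : E, W (coprod.inr : Y ⟶ X ⨿ Y)
  desc : ∀ ⦃X Y Z : E⦄ (f : X ⟶ Z) (g : Y ⟶ Z), W f → W g → W (coprod.desc f g)

/-- `E` is `R`-extensive: the assignment to `U` of the category `R.Over ⊤ U` (objects over `U` whose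
structure morphism is in `R`, and all morphisms over `U`) takes finite coproducts to products, in
the sense that the comparison functors given by pulling back along the coprojections are
equivalences. -/
structure IsExtensive {E : Type u} [Category.{v} E] [HasPullbacks E] [HasFiniteCoproducts E]
    (R : MorphismProperty E) [IsProtocalibration R] : Prop where
  initial : (Functor.star (R.Over ⊤ (⊥_ E)) : _ ⥤ Discrete PUnit.{1}).IsEquivalence
  coprod : ∀ U V : E,
    ((MorphismProperty.Over.pullback R ⊤ (coprod.inl : U ⟶ U ⨿ V)).prod'
      (MorphismProperty.Over.pullback R ⊤ (coprod.inr : V ⟶ U ⨿ V))).IsEquivalence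

section

variable {B : Type*} [Bicategory B]

/-- `T` is a terminal object in the bicategorical sense: each `W ⟶ T` is equivalent to the terminal
category. -/
def IsBiterminal (T : B) : Prop :=
  ∀ W : B, (Functor.star (W ⟶ T) : _ ⥤ Discrete PUnit.{1}).IsEquivalence

/-- `P` with the projections `π₁`, `π₂` is a product of `X` and `Y` in the bicategorical sense:
composing with the projections is an equivalence from `W ⟶ P` to `(W ⟶ X) × (W ⟶ Y)`, for each `W`. -/
def IsBicategoricalProduct {X Y P : B} (π₁ : P ⟶ X) (π₂ : P ⟶ Y) : Prop :=
  ∀ W : B, ((Bicategory.postcomp W π₁).prod' (Bicategory.postcomp W π₂)).IsEquivalence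

variable (B) in
/-- The bicategory `B` has finite products in the bicategorical sense. -/
structure HasFiniteBicategoricalProducts : Prop where
  biterminal : ∃ T : B, IsBiterminal T
  binary : ∀ X Y : B, ∃ (P : B) (π₁ : P ⟶ X) (π₂ : P ⟶ Y), IsBicategoricalProduct π₁ π₂

end

end PolyBicat

open PolyBicat

namespace PolyBicat

/-! A morphism of polynomials `p ⟶ q` is a map `g` out of `p.B` together with a map `l` into `p.A`
from the fibre of `q.n` over `g`. The projection of that fibre to `p.B` is a pullback of a morphism
of `L`, hence lies in `R`; so when `p.B` is a coproduct, extensivity splits the fibre accordingly.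
It follows that cartesian morphisms `p₁ ⟶ p ⟵ p₂` (those with `l` invertible, that is, pullback
squares) form a coproduct diagram as soon as their lower components do: `Poly.isCoprod_of_isCart`.
Adding polynomials componentwise produces such a diagram for every pair, the coprojection squares
being pullbacks by extensivity (`Poly.exists_isCart_isCoprod`).

Left whiskering by `q` preserves cartesian morphisms, and the lower component of the result is the
pullback of the old one along a morphism of the form `Π_n v`, which compatibility puts in `R`
(`Poly.isPullback_whiskerL_g`). By extensivity the whiskered diagram again has a coproduct below, so
precomposition preserves these sums.

For products, the initial object is biterminal: a polynomial into it has `t` in `R` with initial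
codomain, so `B` is initial and the polynomial is an initial object of its hom-category. The product
of `X` and `Y` is `X ⨿ Y`. Its projections are the coprojections read backwards (`Poly.proj`). The
coprojections read forwards (`Poly.inj`) are sections of them, because coprojections are monic. The
counits `π ≫ ι ⟶ 𝟙` are cartesian over the coproduct diagram of `X ⨿ Y`, so whiskering shows that
each polynomial into `X ⨿ Y` is the sum of its two projections reinserted. Conversely, projecting
the sum of reinserted `p₁` and `p₂` to `X` gives `p₁` back, since by extensivity pulling back along
the coprojection isolates the first summand (`Poly.isIso_whiskerR_proj`).
`isBicategoricalProduct_of_isCoprod` turns these facts into an equivalence of hom-categories. -/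

/-- `i₁` and `i₂` exhibit `A` as a coproduct of `A₁` and `A₂`. -/
def IsCoprod {C : Type*} [Category C] {A₁ A₂ A : C} (i₁ : A₁ ⟶ A) (i₂ : A₂ ⟶ A) : Prop :=
  ∀ ⦃Z : C⦄ (f : A₁ ⟶ Z) (g : A₂ ⟶ Z), ∃ h : A ⟶ Z, (i₁ ≫ h = f ∧ i₂ ≫ h = g) ∧
    ∀ h' : A ⟶ Z, i₁ ≫ h' = f → i₂ ≫ h' = g → h' = h

/-! ### Binary coproduct diagrams. -/

namespace IsCoprod

variable {C : Type*} [Category C] {A₁ A₂ A : C} {i₁ : A₁ ⟶ A} {i₂ : A₂ ⟶ A}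

lemma hom_ext (h : IsCoprod i₁ i₂) {Z : C} {f g : A ⟶ Z} (h₁ : i₁ ≫ f = i₁ ≫ g)
    (h₂ : i₂ ≫ f = i₂ ≫ g) : f = g := by
  obtain ⟨k, -, hk⟩ := h (i₁ ≫ g) (i₂ ≫ g)
  rw [hk f h₁ h₂, hk g rfl rfl]

/-- The copairing. -/
noncomputable def desc (h : IsCoprod i₁ i₂) {Z : C} (f : A₁ ⟶ Z) (g : A₂ ⟶ Z) : A ⟶ Z :=
  (h f g).choose

@[simp]
lemma inl_desc (h : IsCoprod i₁ i₂) {Z : C} (f : A₁ ⟶ Z) (g : A₂ ⟶ Z) : i₁ ≫ h.desc f g = f :=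
  (h f g).choose_spec.1.1

@[simp]
lemma inr_desc (h : IsCoprod i₁ i₂) {Z : C} (f : A₁ ⟶ Z) (g : A₂ ⟶ Z) : i₂ ≫ h.desc f g = g :=
  (h f g).choose_spec.1.2

@[simp]
lemma inl_desc_assoc (h : IsCoprod i₁ i₂) {Z Z' : C} (f : A₁ ⟶ Z) (g : A₂ ⟶ Z) (k : Z ⟶ Z') :
    i₁ ≫ h.desc f g ≫ k = f ≫ k := by rw [← Category.assoc, inl_desc]

@[simp]
lemma inr_desc_assoc (h : IsCoprod i₁ i₂) {Z Z' : C} (f : A₁ ⟶ Z) (g : A₂ ⟶ Z) (k : Z ⟶ Z') :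
    i₂ ≫ h.desc f g ≫ k = g ≫ k := by rw [← Category.assoc, inr_desc]

lemma nonempty_isColimit (h : IsCoprod i₁ i₂) : Nonempty (IsColimit (BinaryCofan.mk i₁ i₂)) :=
  ⟨BinaryCofan.IsColimit.mk _ (fun f g => h.desc f g) (fun f g => h.inl_desc f g)
    (fun f g => h.inr_desc f g)
    (fun f g m h₁ h₂ => h.hom_ext (by rw [inl_desc]; exact h₁) (by rw [inr_desc]; exact h₂))⟩

lemma of_isColimit (h : IsColimit (BinaryCofan.mk i₁ i₂)) : IsCoprod i₁ i₂ := fun Z f g =>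
  ⟨(BinaryCofan.IsColimit.desc' h f g).1, (BinaryCofan.IsColimit.desc' h f g).2,
    fun h' h₁ h₂ => BinaryCofan.IsColimit.hom_ext h
      (h₁.trans (BinaryCofan.IsColimit.desc' h f g).2.1.symm)
      (h₂.trans (BinaryCofan.IsColimit.desc' h f g).2.2.symm)⟩

lemma coprod (X Y : C) [HasBinaryCoproduct X Y] :
    IsCoprod (coprod.inl : X ⟶ X ⨿ Y) (coprod.inr : Y ⟶ X ⨿ Y) :=
  of_isColimit (coprodIsCoprod X Y)

lemma symm (h : IsCoprod i₁ i₂) : IsCoprod i₂ i₁ := fun Z f g =>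
  ⟨h.desc g f, ⟨by simp, by simp⟩, fun h' h₁ h₂ => h.hom_ext (by simpa) (by simpa)⟩

lemma comp_iso (h : IsCoprod i₁ i₂) {A' : C} (e : A ⟶ A') [IsIso e] {j₁ : A₁ ⟶ A'}
    {j₂ : A₂ ⟶ A'} (h₁ : i₁ ≫ e = j₁) (h₂ : i₂ ≫ e = j₂) : IsCoprod j₁ j₂ := fun Z f g =>
  ⟨inv e ≫ h.desc f g, ⟨by simp [← h₁], by simp [← h₂]⟩, fun h' hf hg => by
    rw [IsIso.eq_inv_comp]
    exact h.hom_ext (by rw [reassoc_of% h₁]; simpa) (by rw [reassoc_of% h₂]; simpa)⟩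

lemma iso_comp (h : IsCoprod i₁ i₂) {A₁' A₂' : C} (e₁ : A₁' ⟶ A₁) [IsIso e₁] (e₂ : A₂' ⟶ A₂)
    [IsIso e₂] {j₁ : A₁' ⟶ A} {j₂ : A₂' ⟶ A} (h₁ : e₁ ≫ i₁ = j₁) (h₂ : e₂ ≫ i₂ = j₂) :
    IsCoprod j₁ j₂ := fun Z f g =>
  ⟨h.desc (inv e₁ ≫ f) (inv e₂ ≫ g), ⟨by simp [← h₁], by simp [← h₂]⟩, fun h' hf hg =>
    h.hom_ext (by simp [← hf, ← h₁]) (by simp [← hg, ← h₂])⟩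

lemma isIso_desc (h : IsCoprod i₁ i₂) {A' : C} {j₁ : A₁ ⟶ A'} {j₂ : A₂ ⟶ A'}
    (h' : IsCoprod j₁ j₂) : IsIso (h.desc j₁ j₂) :=
  ⟨h'.desc i₁ i₂, h.hom_ext (by simp) (by simp), h'.hom_ext (by simp) (by simp)⟩

lemma of_isInitial {A₂ : C} (h : IsInitial A₂) (i₁ : A₁ ⟶ A) [IsIso i₁] (i₂ : A₂ ⟶ A) :
    IsCoprod i₁ i₂ := fun Z f g =>
  ⟨inv i₁ ≫ f, ⟨by simp, h.hom_ext _ _⟩, fun h' h₁ h₂ => by simpa⟩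

end IsCoprod

/-! ### Extensivity over the initial object. -/

namespace IsExtensive

variable {E : Type u} [Category.{v} E] [HasPullbacks E] [HasFiniteCoproducts E]
  {R : MorphismProperty E} [IsProtocalibration R]

/-- Both `a` and the identity are objects over the initial object with structure map in `R`. Since
the category of such objects is equivalent to a point, they are isomorphic over it, and the
isomorphism is `a` itself. -/
lemma isIso_of_isInitial (hE : IsExtensive R) {A B : E} (hB : IsInitial B) (a : A ⟶ B)
    (ha : R a) : IsIso a := by
  let e : B ≅ ⊥_ E := hB.uniqueUpToIso initialIsInitial
  have := hE.initial
  let o₁ : R.Over ⊤ (⊥_ E) := MorphismProperty.Over.mk ⊤ (a ≫ e.hom)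
    ((R.cancel_right_of_respectsIso _ _).2 ha)
  let o₂ : R.Over ⊤ (⊥_ E) := MorphismProperty.Over.mk ⊤ (𝟙 _) (R.id_mem _)
  let F := (Functor.star (R.Over ⊤ (⊥_ E)) : _ ⥤ Discrete PUnit.{1})
  obtain ⟨k, h₁, h₂⟩ : ∃ k : ⊥_ E ⟶ A, k ≫ a ≫ e.hom = 𝟙 _ ∧ (a ≫ e.hom) ≫ k = 𝟙 _ := by
    let k : o₂ ⟶ o₁ := F.preimage (𝟙 _)
    let k' : o₁ ⟶ o₂ := F.preimage (𝟙 _)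
    have hk' : k'.left = a ≫ e.hom :=
      (Category.comp_id _).symm.trans (MorphismProperty.Over.w k')
    refine ⟨k.left, MorphismProperty.Over.w k, ?_⟩
    rw [← hk']
    exact congrArg (fun f => f.left) (F.map_injective
      (Subsingleton.elim (F.map (k' ≫ k)) (F.map (𝟙 _))))
  exact ⟨e.hom ≫ k, by simpa using h₂, by
    rw [← cancel_epi e.inv, ← cancel_mono e.hom]
    simpa using h₁⟩

end IsExtensive

/-! ### Closure under arbitrary, not only chosen, coproduct diagrams. -/

namespace ClosedUnderFiniteCoproducts

variable {E : Type u} [Category.{v} E] [HasPullbacks E] [HasFiniteCoproducts E]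
  {W : MorphismProperty E} [IsProtocalibration W] {A₁ A₂ A U₁ U₂ U : E}
  {i₁ : A₁ ⟶ A} {i₂ : A₂ ⟶ A}

lemma left_mem (hW : ClosedUnderFiniteCoproducts W) (h : IsCoprod i₁ i₂) : W i₁ := by
  have := (IsCoprod.coprod A₁ A₂).isIso_desc h
  rw [← (IsCoprod.coprod A₁ A₂).inl_desc i₁ i₂]
  exact (W.cancel_right_of_respectsIso _ _).2 (hW.inl _ _)

lemma desc_mem (hW : ClosedUnderFiniteCoproducts W) (h : IsCoprod i₁ i₂) {a : A ⟶ U}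
    (h₁ : W (i₁ ≫ a)) (h₂ : W (i₂ ≫ a)) : W a := by
  have := (IsCoprod.coprod A₁ A₂).isIso_desc h
  rw [← W.cancel_left_of_respectsIso ((IsCoprod.coprod A₁ A₂).desc i₁ i₂)]
  convert hW.desc _ _ h₁ h₂
  exact (IsCoprod.coprod A₁ A₂).hom_ext (by simp [coprod.inl_desc]) (by simp [coprod.inr_desc])

lemma map_mem (hW : ClosedUnderFiniteCoproducts W) (h : IsCoprod i₁ i₂) {j₁ : U₁ ⟶ U}
    {j₂ : U₂ ⟶ U} (hj : IsCoprod j₁ j₂) {a : A ⟶ U} {a₁ : A₁ ⟶ U₁} {a₂ : A₂ ⟶ U₂}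
    (w₁ : i₁ ≫ a = a₁ ≫ j₁) (w₂ : i₂ ≫ a = a₂ ≫ j₂) (h₁ : W a₁) (h₂ : W a₂) : W a :=
  hW.desc_mem h (w₁ ▸ W.comp_mem _ _ h₁ (hW.left_mem hj))
    (w₂ ▸ W.comp_mem _ _ h₂ (hW.left_mem hj.symm))

end ClosedUnderFiniteCoproducts

/-! ### Extensivity for binary coproducts: coproducts versus pullbacks. -/

namespace IsExtensive

variable {E : Type u} [Category.{v} E] [HasPullbacks E] [HasFiniteCoproducts E]
  {R : MorphismProperty E} [IsProtocalibration R] {U₁ U₂ U A₁ A₂ A : E}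

/-- Only full faithfulness of the comparison functor is needed here; closure of `R` under coproducts
makes the sum of the two pullbacks an admissible object over `U ⨿ V`. -/
lemma isIso_desc_pullback (hE : IsExtensive R) (hR : ClosedUnderFiniteCoproducts R)
    {U V : E} (a : A ⟶ U ⨿ V) (ha : R a) :
    IsIso (coprod.desc (pullback.fst a coprod.inl) (pullback.fst a coprod.inr)) := by
  have := hE.coprod U V
  set Φ := (MorphismProperty.Over.pullback R ⊤ (coprod.inl : U ⟶ U ⨿ V)).prod'
      (MorphismProperty.Over.pullback R ⊤ (coprod.inr : V ⟶ U ⨿ V))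
  -- The pullbacks of `d` along the coprojections are not yet known to be its summands, so `ε`
  -- cannot be inverted by reflecting isomorphisms along `Φ`. Instead fullness supplies a retraction
  -- `κ` of `ε`, and faithfulness shows that it is an inverse.
  let d : pullback a coprod.inl ⨿ pullback a coprod.inr ⟶ U ⨿ V :=
    coprod.map (pullback.snd _ _) (pullback.snd _ _)
  have hd : R d := hR.map_mem (IsCoprod.coprod _ _) (IsCoprod.coprod _ _) (coprod.inl_map _ _)
    (coprod.inr_map _ _) (R.pullback_snd _ _ ha) (R.pullback_snd _ _ ha)
  set ε := coprod.desc (pullback.fst a coprod.inl) (pullback.fst a coprod.inr)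
  have hε : ε ≫ a = d := by
    apply coprod.hom_ext <;> simp [ε, d, pullback.condition]
  let o : R.Over ⊤ (U ⨿ V) := MorphismProperty.Over.mk ⊤ a ha
  -- Faithfulness of `Φ`: morphisms over `U ⨿ V` out of `A` are detected on the two pullbacks, hence
  -- after `ε`.
  have inj : ∀ {C : E} (c : C ⟶ U ⨿ V) (hc : R c) (h h' : A ⟶ C), h ≫ c = a → h' ≫ c = a →
      ε ≫ h = ε ≫ h' → h = h' := by
    intro C c hc h h' w w' e
    let oc : R.Over ⊤ (U ⨿ V) := MorphismProperty.Over.mk ⊤ c hc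
    let k : o ⟶ oc := MorphismProperty.Over.homMk h w trivial
    let k' : o ⟶ oc := MorphismProperty.Over.homMk h' w' trivial
    suffices k = k' from congrArg (fun f => f.left) this
    apply Φ.map_injective
    have e₁ := congrArg (coprod.inl ≫ ·) e
    have e₂ := congrArg (coprod.inr ≫ ·) e
    simp only [ε, coprod.inl_desc_assoc, coprod.inr_desc_assoc] at e₁ e₂
    apply Prod.ext
    · apply MorphismProperty.Over.Hom.ext
      apply pullback.hom_ext
      · refine (pullback.lift_fst _ _ _).trans (Eq.trans e₁ (pullback.lift_fst _ _ _).symm)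
      · exact (pullback.lift_snd _ _ _).trans (pullback.lift_snd _ _ _).symm
    · apply MorphismProperty.Over.Hom.ext
      apply pullback.hom_ext
      · refine (pullback.lift_fst _ _ _).trans (Eq.trans e₂ (pullback.lift_fst _ _ _).symm)
      · exact (pullback.lift_snd _ _ _).trans (pullback.lift_snd _ _ _).symm
  let od : R.Over ⊤ (U ⨿ V) := MorphismProperty.Over.mk ⊤ d hd
  let k₁ : (Φ.obj o).1 ⟶ (Φ.obj od).1 := MorphismProperty.Over.homMk
    (pullback.lift coprod.inl (pullback.snd _ _) (coprod.inl_map _ _))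
    (pullback.lift_snd _ _ _) trivial
  let k₂ : (Φ.obj o).2 ⟶ (Φ.obj od).2 := MorphismProperty.Over.homMk
    (pullback.lift coprod.inr (pullback.snd _ _) (coprod.inr_map _ _))
    (pullback.lift_snd _ _ _) trivial
  let k : o ⟶ od := Φ.preimage (X := o) (Y := od) (Prod.mkHom k₁ k₂)
  have hk : Φ.map k = (Prod.mkHom k₁ k₂) := Φ.map_preimage _
  obtain ⟨κ, h₁, h₂, hκ⟩ : ∃ κ : A ⟶ pullback a coprod.inl ⨿ pullback a coprod.inr,
      pullback.fst a coprod.inl ≫ κ = coprod.inl ∧ pullback.fst a coprod.inr ≫ κ = coprod.inr ∧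
      κ ≫ d = a := by
    refine ⟨k.left, ?_, ?_, MorphismProperty.Over.w k⟩
    · have h := congrArg (fun f => (f.1).left ≫ pullback.fst d coprod.inl) hk
      exact (pullback.lift_fst _ _ _).symm.trans (h.trans (pullback.lift_fst _ _ _))
    · have h := congrArg (fun f => (f.2).left ≫ pullback.fst d coprod.inr) hk
      exact (pullback.lift_fst _ _ _).symm.trans (h.trans (pullback.lift_fst _ _ _))
  have hl : ε ≫ κ = 𝟙 _ := by
    apply coprod.hom_ext <;> simp [ε, h₁, h₂]
  refine ⟨κ, hl, inj a ha _ _ (by rw [Category.assoc, hε, hκ]) (Category.id_comp _) ?_⟩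
  rw [← Category.assoc, hl, Category.id_comp, Category.comp_id]

variable {i₁ : U₁ ⟶ U} {i₂ : U₂ ⟶ U}

/-- Coproducts are stable under pullback along morphisms of `R`. -/
lemma isCoprod_of_isPullback (hE : IsExtensive R) (hR : ClosedUnderFiniteCoproducts R)
    (h : IsCoprod i₁ i₂) {a : A ⟶ U} (ha : R a) {a₁ : A₁ ⟶ U₁} {a₂ : A₂ ⟶ U₂} {j₁ : A₁ ⟶ A}
    {j₂ : A₂ ⟶ A} (h₁ : IsPullback j₁ a₁ a i₁) (h₂ : IsPullback j₂ a₂ a i₂) : IsCoprod j₁ j₂ := by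
  let e := h.desc (coprod.inl : U₁ ⟶ U₁ ⨿ U₂) coprod.inr
  have : IsIso e := h.isIso_desc (IsCoprod.coprod _ _)
  have := hE.isIso_desc_pullback hR (a ≫ e) ((R.cancel_right_of_respectsIso _ _).2 ha)
  have h₁' : IsPullback j₁ (a₁ ≫ 𝟙 _) (a ≫ e) coprod.inl :=
    h₁.paste_vert (IsPullback.of_vert_isIso ⟨by simp [e]⟩)
  have h₂' : IsPullback j₂ (a₂ ≫ 𝟙 _) (a ≫ e) coprod.inr :=
    h₂.paste_vert (IsPullback.of_vert_isIso ⟨by simp [e]⟩)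
  exact ((IsCoprod.coprod _ _).comp_iso (coprod.desc (pullback.fst (a ≫ e) coprod.inl)
    (pullback.fst (a ≫ e) coprod.inr)) rfl rfl).iso_comp h₁'.isoPullback.hom h₂'.isoPullback.hom
    (by simp [coprod.inl_desc]) (by simp [coprod.inr_desc])

/-- This is essential surjectivity of the comparison functor, transported from `U₁ ⨿ U₂` to `U`. -/
lemma exists_isPullback (hE : IsExtensive R) (hR : ClosedUnderFiniteCoproducts R)
    (h : IsCoprod i₁ i₂) {a₁ : A₁ ⟶ U₁} {a₂ : A₂ ⟶ U₂} (ha₁ : R a₁) (ha₂ : R a₂) :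
    ∃ (C : E) (c : C ⟶ U) (j₁ : A₁ ⟶ C) (j₂ : A₂ ⟶ C), R c ∧ IsPullback j₁ a₁ c i₁ ∧
      IsPullback j₂ a₂ c i₂ := by
  have := hE.coprod U₁ U₂
  let Φ := (MorphismProperty.Over.pullback R ⊤ (coprod.inl : U₁ ⟶ U₁ ⨿ U₂)).prod'
      (MorphismProperty.Over.pullback R ⊤ (coprod.inr : U₂ ⟶ U₁ ⨿ U₂))
  let o : R.Over ⊤ U₁ × R.Over ⊤ U₂ :=
    (MorphismProperty.Over.mk ⊤ a₁ ha₁, MorphismProperty.Over.mk ⊤ a₂ ha₂)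
  let c := Φ.objPreimage o
  let θ := Φ.objObjPreimageIso o
  let e := (IsCoprod.coprod U₁ U₂).desc i₁ i₂
  have : IsIso e := (IsCoprod.coprod U₁ U₂).isIso_desc h
  obtain ⟨k₁, hi₁, hk₁⟩ : ∃ k : A₁ ⟶ pullback c.hom coprod.inl, IsIso k ∧
      k ≫ pullback.snd _ _ = a₁ := by
    let t := ((MorphismProperty.Over.forget R ⊤ _ ⋙ Over.forget _).mapIso
      ((CategoryTheory.Prod.fst _ _).mapIso θ.symm))
    exact ⟨t.hom, t.isIso_hom, MorphismProperty.Over.w θ.inv.1⟩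
  obtain ⟨k₂, hi₂, hk₂⟩ : ∃ k : A₂ ⟶ pullback c.hom coprod.inr, IsIso k ∧
      k ≫ pullback.snd _ _ = a₂ := by
    let t := ((MorphismProperty.Over.forget R ⊤ _ ⋙ Over.forget _).mapIso
      ((CategoryTheory.Prod.snd _ _).mapIso θ.symm))
    exact ⟨t.hom, t.isIso_hom, MorphismProperty.Over.w θ.inv.2⟩
  refine ⟨c.left, c.hom ≫ e, k₁ ≫ pullback.fst _ _, k₂ ≫ pullback.fst _ _,
    (R.cancel_right_of_respectsIso _ _).2 c.prop, ?_, ?_⟩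
  · have h := ((IsPullback.of_vert_isIso (fst := k₁ ≫ pullback.fst _ _) (snd := k₁) (f := 𝟙 _)
      (g := pullback.fst _ _) ⟨by simp⟩).paste_vert (IsPullback.of_hasPullback c.hom
      (coprod.inl : U₁ ⟶ U₁ ⨿ U₂))).paste_vert (IsPullback.of_vert_isIso (snd := 𝟙 _) (f := e)
      (g := i₁) ⟨by simp [e]⟩)
    rw [hk₁] at h
    simpa using h
  · have h := ((IsPullback.of_vert_isIso (fst := k₂ ≫ pullback.fst _ _) (snd := k₂) (f := 𝟙 _)
      (g := pullback.fst _ _) ⟨by simp⟩).paste_vert (IsPullback.of_hasPullback c.hom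
      (coprod.inr : U₂ ⟶ U₁ ⨿ U₂))).paste_vert (IsPullback.of_vert_isIso (snd := 𝟙 _) (f := e)
      (g := i₂) ⟨by simp [e]⟩)
    rw [hk₂] at h
    simpa using h

/-- Glue `a₁` and `a₂` to some `c : C ⟶ U` with the required pullback squares. These squares present
`C` as a coproduct of `A₁` and `A₂`, so `C` is isomorphic to `A` over `U` and the squares carry
over. -/
lemma isPullback_of_isCoprod (hE : IsExtensive R) (hR : ClosedUnderFiniteCoproducts R)
    (h : IsCoprod i₁ i₂) {j₁ : A₁ ⟶ A} {j₂ : A₂ ⟶ A} (hj : IsCoprod j₁ j₂) {a : A ⟶ U}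
    {a₁ : A₁ ⟶ U₁} {a₂ : A₂ ⟶ U₂} (ha₁ : R a₁) (ha₂ : R a₂) (w₁ : j₁ ≫ a = a₁ ≫ i₁)
    (w₂ : j₂ ≫ a = a₂ ≫ i₂) : IsPullback j₁ a₁ a i₁ ∧ IsPullback j₂ a₂ a i₂ := by
  obtain ⟨C, c, k₁, k₂, hc, h₁, h₂⟩ := hE.exists_isPullback hR h ha₁ ha₂
  have hk := hE.isCoprod_of_isPullback hR h hc h₁ h₂
  have := hk.isIso_desc hj
  have hd : hk.desc j₁ j₂ ≫ a = c := hk.hom_ext (by simp [w₁, h₁.w]) (by simp [w₂, h₂.w])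
  exact ⟨h₁.of_iso (Iso.refl _) (asIso (hk.desc j₁ j₂)) (Iso.refl _) (Iso.refl _) (by simp)
      (by simp) (by simp [hd]) (by simp),
    h₂.of_iso (Iso.refl _) (asIso (hk.desc j₁ j₂)) (Iso.refl _) (Iso.refl _) (by simp)
      (by simp) (by simp [hd]) (by simp)⟩

/-- Viewing `U₁` as a coproduct of itself and the initial object, the map `i₁` is a sum of two maps
in `R`, so the square with sides `𝟙`, `𝟙`, `i₁`, `i₁` is a pullback. -/
lemma mono_of_isCoprod (hE : IsExtensive R) (hR : ClosedUnderFiniteCoproducts R)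
    (h : IsCoprod i₁ i₂) : Mono i₁ := by
  obtain ⟨hp, -⟩ := hE.isPullback_of_isCoprod hR h (IsCoprod.of_isInitial initialIsInitial
    (𝟙 U₁) (initial.to U₁)) (R.id_mem _) (hR.initial_to U₂) (a := i₁) (by simp)
    (initialIsInitial.hom_ext _ _)
  exact ⟨fun f g e => by
    rw [← hp.lift_fst f g e, Category.comp_id]
    simpa using hp.lift_snd f g e⟩

end IsExtensive

/-! ### Cartesian morphisms of polynomials. -/

namespace Poly

variable {E : Type u} [Category.{v} E] [HasPullbacks E] {L R : MorphismProperty E} {X Y W : E}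

section

variable {p q s : Poly L R X Y}

lemma isPullback_fib (p : Poly L R X Y) {Z : E} (b : Z ⟶ p.B) :
    IsPullback (p.ι b) (p.π b) p.n b :=
  (IsPullback.of_hasPullback b p.n).flip

lemma isPullback_fibMap (p : Poly L R X Y) {Z Z' : E} (u : Z' ⟶ Z) {b : Z ⟶ p.B} {b' : Z' ⟶ p.B}
    (h : u ≫ b = b') : IsPullback (p.fibMap u h) (p.π b') (p.π b) u := by
  refine IsPullback.of_right ?_ (p.fibMap_π u h) (p.isPullback_fib b)
  rw [fibMap_ι, h]
  exact p.isPullback_fib b'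

instance (p : Poly L R X Y) [IsIso p.n] {Z : E} (b : Z ⟶ p.B) : IsIso (p.π b) :=
  inferInstanceAs (IsIso (pullback.fst b p.n))

instance (p : Poly L R X Y) {Z : E} (b : Z ⟶ p.B) [IsIso b] : IsIso (p.ι b) :=
  inferInstanceAs (IsIso (pullback.snd b p.n))

instance isIso_fibMap (p : Poly L R X Y) {Z Z' : E} (u : Z' ⟶ Z) [IsIso u] {b : Z ⟶ p.B}
    {b' : Z' ⟶ p.B} (h : u ≫ b = b') : IsIso (p.fibMap u h) :=
  ⟨p.fibMap (inv u) (by simp [← h]), fib_ext (by simp) (by simp), fib_ext (by simp) (by simp)⟩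

namespace Hom

/-- A morphism of polynomials is cartesian when its component `l` is invertible, so that
it amounts to a pullback square. -/
abbrev IsCart (f : Hom p q) : Prop := IsIso f.l

section

variable (f : Hom p q) [IsIso f.l]

/-- The upper edge of the pullback square given by a cartesian morphism. -/
noncomputable def top : p.A ⟶ q.A := inv f.l ≫ q.ι f.g

lemma l_top : f.l ≫ f.top = q.ι f.g := by simp [top]

lemma top_r : f.top ≫ q.r = p.r := by
  rw [top, Category.assoc, ← f.l_r, IsIso.inv_hom_id_assoc]

lemma isPullback_top : IsPullback f.top p.n q.n f.g :=
  (q.isPullback_fib f.g).of_iso (asIso f.l) (Iso.refl _) (Iso.refl _) (Iso.refl _)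
    (by simp [l_top]) (by simp) (by simp) (by simp)

instance isIso_act {Z : E} (b : Z ⟶ p.B) : IsIso (f.act b) := by
  have h : p.π b ≫ b ≫ f.g = (p.ι b ≫ f.top) ≫ q.n := by
    rw [Category.assoc, f.isPullback_top.w, ← Category.assoc, π_ι, Category.assoc]
  refine ⟨q.lift (p.π b) (p.ι b ≫ f.top) h, fib_ext ?_ ?_, fib_ext ?_ ?_⟩
  · simp
  · rw [Category.assoc, lift_ι, ← Category.assoc, act_ι, Category.assoc, l_top, fibMap_ι,
      Category.id_comp]
  · simp
  · have : q.lift (p.π b) (p.ι b ≫ f.top) h ≫ q.fibMap b rfl = p.ι b ≫ inv f.l :=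
      fib_ext (by rw [Category.assoc, fibMap_π, lift_π_assoc, π_ι, Category.assoc, ← f.l_n,
        IsIso.inv_hom_id_assoc]) (by simp [top])
    simp [reassoc_of% this]

end

/-- The action on the fibre over the universal element `𝟙 p.B` is `l` up to canonical isomorphisms,
so invertibility need only be tested there. -/
lemma isCart_of_isIso_act (f : Hom p q) [IsIso (f.act (𝟙 p.B))] : f.IsCart := by
  have h : f.l = inv (q.fibMap (𝟙 p.B) (b := f.g) rfl) ≫ f.act (𝟙 p.B) ≫ p.ι _ := by simp
  rw [IsCart, h]
  infer_instance

/-- The morphism of polynomials given by a pullback square. -/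
noncomputable def ofIsPullback {g : p.B ⟶ q.B} {k : p.A ⟶ q.A} (h : IsPullback k p.n q.n g)
    (ht : g ≫ q.t = p.t) (hr : k ≫ q.r = p.r) : Hom p q where
  g := g
  l := h.lift (q.ι g) (q.π g) (q.π_ι g).symm
  g_t := ht
  l_n := h.lift_snd _ _ _
  l_r := by rw [← hr, h.lift_fst_assoc]

section

variable {g : p.B ⟶ q.B} {k : p.A ⟶ q.A} (h : IsPullback k p.n q.n g)
  (ht : g ≫ q.t = p.t) (hr : k ≫ q.r = p.r)

lemma ofIsPullback_isCart : (ofIsPullback h ht hr).IsCart :=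
  ⟨q.lift (b := g) p.n k h.w.symm, fib_ext
    ((Category.assoc _ _ _).trans ((congrArg (_ ≫ ·) (lift_π _ _ _ _)).trans
      ((h.lift_snd _ _ _).trans (Category.id_comp _).symm)))
    ((Category.assoc _ _ _).trans ((congrArg (_ ≫ ·) (lift_ι _ _ _ _)).trans
      ((h.lift_fst _ _ _).trans (Category.id_comp _).symm))),
    h.hom_ext (by simp [ofIsPullback]) (by simp [ofIsPullback])⟩

lemma ofIsPullback_l : (ofIsPullback h ht hr).l ≫ k = q.ι g := h.lift_fst _ _ _

end

end Hom

lemma comp_g (f : p ⟶ q) (h : q ⟶ s) : Hom.g (f ≫ h) = Hom.g f ≫ Hom.g h := rfl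

lemma fibMap_l_of_comp (f : p ⟶ q) [hf : IsIso (Hom.l f)] (h : q ⟶ s) :
    s.fibMap (Hom.g f) (comp_g f h).symm ≫ Hom.l h = Hom.l (f ≫ h) ≫ Hom.top f := by
  change _ = (q.lift _ (s.lift _ _ _ ≫ Hom.l h) _ ≫ Hom.l f) ≫ _
  rw [Category.assoc, Hom.l_top, lift_ι]
  rfl

/-- Since `p.A` is the pullback of `q.A` along `f.g`, a map into it over `p.B` is determined by its
composite with `f.top`. Composites out of a cartesian morphism can thus be compared in `q.A`. -/
lemma comp_eq_of_isCart (f : p ⟶ q) [hf : IsIso (Hom.l f)] (h : q ⟶ s) (e : p ⟶ s)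
    (hg : Hom.g f ≫ Hom.g h = Hom.g e)
    (hl : s.fibMap (Hom.g f) hg ≫ Hom.l h = Hom.l e ≫ Hom.top f) : f ≫ h = e := by
  refine Hom.ext' hg ?_
  apply (Hom.isPullback_top f).hom_ext
  · rw [← fibMap_l_of_comp, Category.assoc, ← hl, ← Category.assoc, fibMap_fibMap]
    exact congrArg (· ≫ _) (s.fibMap_congr (Category.id_comp _).symm _ _)
  · rw [Hom.l_n, Category.assoc, Hom.l_n, fibMap_π, Category.comp_id]

lemma exists_comp_eq_id (f : p ⟶ q) [IsIso (Hom.l f)] [IsIso (Hom.g f)] :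
    ∃ h : q ⟶ p, IsIso (Hom.l h) ∧ IsIso (Hom.g h) ∧ f ≫ h = 𝟙 p := by
  have := (Hom.isPullback_top f).isIso_fst_of_isIso
  have hp : IsPullback (inv (Hom.top f)) q.n p.n (inv (Hom.g f)) :=
    IsPullback.of_horiz_isIso ⟨by
      rw [IsIso.inv_comp_eq, ← Category.assoc, (Hom.isPullback_top f).w, Category.assoc,
        IsIso.hom_inv_id, Category.comp_id]⟩
  let h : q ⟶ p := Hom.ofIsPullback hp (by rw [← Hom.g_t f, IsIso.inv_hom_id_assoc])
    (by rw [← Hom.top_r f, IsIso.inv_hom_id_assoc])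
  have hl : Hom.l h = p.ι (inv (Hom.g f)) ≫ Hom.top f :=
    (IsIso.comp_inv_eq _).1 (Hom.ofIsPullback_l hp _ _)
  refine ⟨h, Hom.ofIsPullback_isCart hp _ _, inferInstanceAs (IsIso (inv (Hom.g f))), ?_⟩
  refine comp_eq_of_isCart f h _ (IsIso.hom_inv_id _) ?_
  rw [hl]
  exact p.fibMap_ι_assoc _ _ _

/-- The right inverse `h` from `exists_comp_eq_id` is of the same kind, so it has a right inverse
too, which must be `f`. -/
lemma isIso_of_isCart (f : p ⟶ q) [IsIso (Hom.l f)] [IsIso (Hom.g f)] : IsIso f := by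
  obtain ⟨h, _, _, e⟩ := exists_comp_eq_id f
  obtain ⟨f', _, _, e'⟩ := exists_comp_eq_id h
  obtain rfl : f = f' := by rw [← Category.comp_id f, ← e', reassoc_of% e]
  exact ⟨h, e, e'⟩

end

/-! ### Finite coproducts of polynomials. -/

section

variable [HasFiniteCoproducts E] [IsProtocalibration L] [IsProtocalibration R] [IsCompatible L R]

lemma n_mem_right (p : Poly L R X Y) : R p.n := IsCompatible.le (L := L) _ p.n_mem

lemma π_mem (p : Poly L R X Y) {Z : E} (b : Z ⟶ p.B) : R (p.π b) :=
  R.pullback_fst _ _ p.n_mem_right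

/-- Cartesian morphisms whose lower components form a coproduct diagram form a coproduct diagram
of polynomials. -/
lemma isCoprod_of_isCart (hE : IsExtensive R) (hR : ClosedUnderFiniteCoproducts R)
    {p₁ p₂ p : Poly L R X Y} (f₁ : p₁ ⟶ p) (f₂ : p₂ ⟶ p) [IsIso (Hom.l f₁)] [IsIso (Hom.l f₂)]
    (h : IsCoprod (Hom.g f₁) (Hom.g f₂)) : IsCoprod f₁ f₂ := by
  intro q h₁ h₂
  -- The fibre of `q.n` over `g` projects to `p.B` by a morphism of `R`, so it is the coproduct of
  -- the fibres over the two restrictions of `g`.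
  have key : ∀ (g : p.B ⟶ q.B) {b₁ : p₁.B ⟶ q.B} {b₂ : p₂.B ⟶ q.B} (e₁ : Hom.g f₁ ≫ g = b₁)
      (e₂ : Hom.g f₂ ≫ g = b₂), IsCoprod (q.fibMap (Hom.g f₁) e₁) (q.fibMap (Hom.g f₂) e₂) :=
    fun g _ _ e₁ e₂ => hE.isCoprod_of_isPullback hR h (q.π_mem g) (q.isPullback_fibMap _ e₁)
      (q.isPullback_fibMap _ e₂)
  have hF := key (h.desc (Hom.g h₁) (Hom.g h₂)) (h.inl_desc _ _) (h.inr_desc _ _)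
  let k : p ⟶ q := Hom.mk (h.desc (Hom.g h₁) (Hom.g h₂))
    (hF.desc (Hom.l h₁ ≫ Hom.top f₁) (Hom.l h₂ ≫ Hom.top f₂))
    (h.hom_ext (by simp) (by simp))
    (hF.hom_ext
      (by rw [IsCoprod.inl_desc_assoc, Category.assoc, (Hom.isPullback_top f₁).w, fibMap_π,
        ← Category.assoc, Hom.l_n])
      (by rw [IsCoprod.inr_desc_assoc, Category.assoc, (Hom.isPullback_top f₂).w, fibMap_π,
        ← Category.assoc, Hom.l_n]))
    (hF.hom_ext (by simp [Hom.top_r]) (by simp [Hom.top_r]))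
  have hk₁ : f₁ ≫ k = h₁ := comp_eq_of_isCart f₁ k h₁ (h.inl_desc _ _) (hF.inl_desc _ _)
  have hk₂ : f₂ ≫ k = h₂ := comp_eq_of_isCart f₂ k h₂ (h.inr_desc _ _) (hF.inr_desc _ _)
  refine ⟨k, ⟨hk₁, hk₂⟩, ?_⟩
  rintro k' rfl rfl
  have hg : Hom.g k' = Hom.g k :=
    h.hom_ext (congrArg Hom.g hk₁).symm (congrArg Hom.g hk₂).symm
  -- Once the lower components agree, `l` is determined on the two parts of the fibre by
  -- `fibMap_l_of_comp`.
  refine Hom.ext' hg ((key (Hom.g k') rfl rfl).hom_ext ?_ ?_)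
  · rw [← Category.assoc, fibMap_fibMap]
    exact (fibMap_l_of_comp f₁ k').trans ((hF.inl_desc _ _).symm.trans
      (congrArg (· ≫ _) (q.fibMap_congr (Category.comp_id _).symm _ _)))
  · rw [← Category.assoc, fibMap_fibMap]
    exact (fibMap_l_of_comp f₂ k').trans ((hF.inr_desc _ _).symm.trans
      (congrArg (· ≫ _) (q.fibMap_congr (Category.comp_id _).symm _ _)))

/-- A polynomial `X ⟵ A ⟶ B ⟶ Y` with `B` initial is initial. -/
lemma nonempty_isInitial (hE : IsExtensive R) (p : Poly L R X Y) (hp : IsInitial p.B) :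
    Nonempty (IsInitial p) := by
  -- The projection of the fibre is in `R` and has initial codomain, so the fibre is initial too;
  -- both components of a morphism out of `p` are then forced.
  have hF : ∀ {q : Poly L R X Y} (b : p.B ⟶ q.B), Nonempty (IsInitial (q.fib b)) := fun {q} b => by
    have := hE.isIso_of_isInitial hp (q.π b) (q.π_mem b)
    exact ⟨hp.ofIso (asIso (q.π b)).symm⟩
  have : ∀ q : Poly L R X Y, Nonempty (Unique (p ⟶ q)) := fun q =>
    ⟨⟨Hom.mk (hp.to _) ((hF _).some.to _) (hp.hom_ext _ _)
      ((hF _).some.hom_ext _ _) ((hF _).some.hom_ext _ _)⟩, fun f => Hom.ext' (hp.hom_ext _ _)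
        ((hF _).some.hom_ext _ _)⟩
  have := fun q => (this q).some
  exact ⟨IsInitial.ofUnique p⟩

/-- The sum of two polynomials. -/
noncomputable def sum (hL : ClosedUnderFiniteCoproducts L) (hR : ClosedUnderFiniteCoproducts R)
    (p₁ p₂ : Poly L R X Y) : Poly L R X Y where
  A := p₁.A ⨿ p₂.A
  B := p₁.B ⨿ p₂.B
  r := coprod.desc p₁.r p₂.r
  n := coprod.map p₁.n p₂.n
  t := coprod.desc p₁.t p₂.t
  n_mem := hL.map_mem (IsCoprod.coprod _ _) (IsCoprod.coprod _ _) (coprod.inl_map _ _)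
    (coprod.inr_map _ _) p₁.n_mem p₂.n_mem
  t_mem := hR.desc _ _ p₁.t_mem p₂.t_mem

lemma exists_isCart_isCoprod (hE : IsExtensive R) (hL : ClosedUnderFiniteCoproducts L)
    (hR : ClosedUnderFiniteCoproducts R) (p₁ p₂ : Poly L R X Y) :
    ∃ (p : Poly L R X Y) (f₁ : p₁ ⟶ p) (f₂ : p₂ ⟶ p), IsIso (Hom.l f₁) ∧ IsIso (Hom.l f₂) ∧
      IsCoprod (Hom.g f₁) (Hom.g f₂) := by
  obtain ⟨h₁, h₂⟩ := hE.isPullback_of_isCoprod hR (IsCoprod.coprod p₁.B p₂.B)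
    (IsCoprod.coprod p₁.A p₂.A) p₁.n_mem_right p₂.n_mem_right (coprod.inl_map p₁.n p₂.n)
    (coprod.inr_map p₁.n p₂.n)
  exact ⟨sum hL hR p₁ p₂, Hom.ofIsPullback (q := sum hL hR p₁ p₂) h₁ (coprod.inl_desc _ _)
      (coprod.inl_desc _ _), Hom.ofIsPullback (q := sum hL hR p₁ p₂) h₂ (coprod.inr_desc _ _)
      (coprod.inr_desc _ _), Hom.ofIsPullback_isCart _ _ _, Hom.ofIsPullback_isCart _ _ _,
    IsCoprod.coprod _ _⟩

lemma exists_isInitial (hR : ClosedUnderFiniteCoproducts R) :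
    ∃ p : Poly L R X Y, Nonempty (IsInitial p.B) :=
  ⟨⟨⊥_ E, ⊥_ E, initial.to _, 𝟙 _, initial.to _, L.id_mem _, hR.initial_to _⟩,
    ⟨initialIsInitial⟩⟩

end

end Poly

/-! ### Whiskering, read off on generalised elements. -/

namespace Poly

variable {E : Type u} [Category.{v} E] [HasPullbacks E] {L R : MorphismProperty E}
  [IsProtocalibration L] [IsProtocalibration R] [IsCompatible L R] {X Y W : E}

/-- A form of `substLift_ev` for an element and a base point known only up to propositional
equality, as they occur when actions are evaluated at universal elements. -/
lemma fibMap_substEv_of_eq (p : Poly L R X Y) (q : Poly L R Y W) {Z : E}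
    {c : Z ⟶ (p.subst q).left} {b : Z ⟶ q.B} {β : q.fib b ⟶ p.B} {h : β ≫ p.t = q.ι b ≫ q.r}
    (hc : c = p.substLift q b β h) {b' : Z ⟶ q.B} (hb' : c ≫ (p.subst q).hom = b')
    (e : 𝟙 Z ≫ b = b') :
    q.fibMap c hb' ≫ p.substEv q = q.fibMap (𝟙 Z) e ≫ β := by
  obtain rfl : b = b' := (Category.id_comp _).symm.trans e
  subst hc
  rw [fibMap_id, Category.id_comp]
  exact p.substLift_ev q b β h

instance isIso_unnest (p : Poly L R X Y) (q : Poly L R Y W) {Z : E} (c : Z ⟶ (p.comp q).B)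
    {b : Z ⟶ q.B} (hb : c ≫ (p.subst q).hom = b) {β : q.fib b ⟶ p.B}
    (hβ : q.fibMap c hb ≫ p.substEv q = β) : IsIso (unnest p q c hb hβ) :=
  ⟨nest p q c hb hβ, unnest_nest _ _, nest_unnest _ _⟩

instance isIso_nest (p : Poly L R X Y) (q : Poly L R Y W) {Z : E} (c : Z ⟶ (p.comp q).B)
    {b : Z ⟶ q.B} (hb : c ≫ (p.subst q).hom = b) {β : q.fib b ⟶ p.B}
    (hβ : q.fibMap c hb ≫ p.substEv q = β) : IsIso (nest p q c hb hβ) :=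
  ⟨unnest p q c hb hβ, nest_unnest _ _, unnest_nest _ _⟩

section

variable (p : Poly L R X Y) {q q' : Poly L R Y W} (h : q ⟶ q')

/-- Left whiskering of morphisms of polynomials. -/
noncomputable def whiskerL : p.comp q ⟶ p.comp q' :=
  (plyRep L R).whiskerL (X := ⟨X⟩) (Y := ⟨Y⟩) (Z := ⟨W⟩) p h

/-- Whiskering is defined through full faithfulness of the extension, so it acts by unpacking an
element of the composite, applying `h`, and repacking. At the universal element this yields both
components of the whiskered morphism. -/
lemma whiskerL_actEl {T : Test X} {Z : E} {y : Z ⟶ W} (s : (p.comp q).ExtEl T y) :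
    Hom.actEl (whiskerL p h) s = ExtEl.unnest (Hom.actEl h s.nest) :=
  congrArg (fun α => Test.Hom.app (α.app T) y s)
    ((extFullyFaithful L R X W).map_preimage ((extComp p q).hom ≫
      Functor.whiskerLeft p.extFunctor (Hom.toNat h) ≫ (extComp p q').inv))

lemma whiskerL_g_hom : Hom.g (whiskerL p h) ≫ (p.subst q').hom = (p.subst q).hom ≫ Hom.g h := by
  obtain ⟨h₁, -⟩ := extEl_eq _ _ (whiskerL_actEl p h (bareEl (𝟙 (p.comp q).B)))
  rw [← Category.id_comp (Hom.g (whiskerL p h)), ← Category.id_comp (p.subst q).hom]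
  exact (congrArg (· ≫ (p.subst q').hom) h₁).trans (p.substLift_hom q' _ _ _)

lemma fibMap_whiskerL_g (e : Hom.g (whiskerL p h) ≫ (p.subst q').hom = (p.subst q).hom ≫ Hom.g h) :
    q'.fibMap (Hom.g (whiskerL p h)) e ≫ p.substEv q' =
      Hom.act h (p.subst q).hom ≫ p.substEv q := by
  obtain ⟨h₁, -⟩ := extEl_eq _ _ (whiskerL_actEl p h (bareEl (𝟙 (p.comp q).B)))
  have h₂ := p.fibMap_substEv_of_eq q' h₁ (b' := (p.subst q).hom ≫ Hom.g h)
    ((Category.assoc _ _ _).trans ((Category.id_comp _).trans e)) (by simp)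
  refine (congrArg (· ≫ p.substEv q') (q'.fibMap_congr (Category.id_comp _).symm _ _)).trans
    (h₂.trans ?_)
  change _ ≫ Hom.act h (𝟙 _ ≫ _) ≫ q.fibMap (𝟙 _) rfl ≫ _ = _
  rw [← Category.assoc (Hom.act h _), Hom.act_fibMap, ← Category.assoc, ← Category.assoc,
    fibMap_fibMap]
  exact congrArg (· ≫ p.substEv q) ((congrArg (· ≫ Hom.act h _) ((q'.fibMap_congr
    (Category.comp_id _) _ (Category.id_comp _)).trans (q'.fibMap_id _))).trans (Category.id_comp _))

instance whiskerL_isCart [IsIso (Hom.l h)] : IsIso (Hom.l (whiskerL p h)) := by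
  obtain ⟨h₁, h₂⟩ := extEl_eq _ _ (whiskerL_actEl p h (bareEl (𝟙 (p.comp q).B)))
  -- On fibres, whiskering passes to iterated fibres, applies the base change of `h.act`, and passes
  -- back. Each factor is invertible when `h` is cartesian.
  have h₃ : Hom.act (whiskerL p h) (𝟙 _) ≫ 𝟙 _ =
    (p.comp q').fibMap (𝟙 _) _ ≫ nest p q' _ _ _ ≫ p.fibMap (Hom.act h _) _ ≫
      unnest p q _ _ _ ≫ 𝟙 _ := congrArg Subtype.val h₂
  have : IsIso (Hom.act (whiskerL p h) (𝟙 _)) := by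
    rw [← Category.comp_id (Hom.act (whiskerL p h) (𝟙 _)), h₃]
    infer_instance
  exact Hom.isCart_of_isIso_act _

/-- Left whiskering of a cartesian morphism gives a pullback square on lower components. -/
lemma isPullback_whiskerL_g [IsIso (Hom.l h)] :
    IsPullback (Hom.g (whiskerL p h)) (p.subst q).hom (p.subst q').hom (Hom.g h) := by
  have w := whiskerL_g_hom p h
  -- An element of `p.subst q` over `b` is a map from the fibre of `q.n` over `b` to `p.B`;
  -- whiskering precomposes this map with `h.act b`. For cartesian `h` that is a bijection onto the
  -- elements of `p.subst q'` over `b ≫ h.g`, which is the pullback property.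
  have key : ∀ {Z : E} (c : Z ⟶ (p.subst q).left) {b : Z ⟶ q.B} (hc : c ≫ (p.subst q).hom = b),
      q'.fibMap (c ≫ Hom.g (whiskerL p h)) (by rw [Category.assoc, w, ← hc, Category.assoc]) ≫
        p.substEv q' = Hom.act h b ≫ q.fibMap c hc ≫ p.substEv q := by
    rintro Z c _ rfl
    rw [← q'.fibMap_fibMap _ w (Category.assoc _ _ _).symm, Category.assoc (q'.fibMap _ _),
      fibMap_whiskerL_g p h w, ← Category.assoc (Hom.act h _), Hom.act_fibMap,
      Category.assoc (q'.fibMap _ _)]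
  have aux : ∀ s : PullbackCone (p.subst q').hom (Hom.g h),
      (inv (Hom.act h s.snd) ≫ q'.fibMap s.fst s.condition ≫ p.substEv q') ≫ p.t =
        q.ι s.snd ≫ q.r := fun s => by
    rw [Category.assoc, IsIso.inv_comp_eq, Category.assoc, substEv_t, fibMap_ι_assoc, Hom.act_lab]
  refine ⟨⟨w⟩, ⟨PullbackCone.IsLimit.mk _ (fun s => p.substLift q s.snd _ (aux s)) ?_ ?_ ?_⟩⟩
  · intro s
    have hc := p.substLift_hom q s.snd _ (aux s)
    refine p.subst_ext q' (b := s.snd ≫ Hom.g h) (by rw [Category.assoc, w, ← Category.assoc, hc])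
      s.condition ?_
    rw [key _ hc, p.substLift_ev, IsIso.hom_inv_id_assoc]
  · intro s
    exact p.substLift_hom q _ _ _
  · intro s m h₁ h₂
    refine p.subst_ext q h₂ (p.substLift_hom q s.snd _ (aux s)) ?_
    rw [p.substLift_ev, IsIso.eq_inv_comp, ← key]
    exact congrArg (· ≫ _) (q'.fibMap_congr h₁ _ _)

end

section

variable {p p' : Poly L R X Y} (f : p ⟶ p') (q : Poly L R Y W)

/-- Right whiskering of morphisms of polynomials. -/
noncomputable def whiskerR : p.comp q ⟶ p'.comp q :=
  (plyRep L R).whiskerR (X := ⟨X⟩) (Y := ⟨Y⟩) (Z := ⟨W⟩) f q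

lemma whiskerR_actEl {T : Test X} {Z : E} {y : Z ⟶ W} (s : (p.comp q).ExtEl T y) :
    Hom.actEl (whiskerR f q) s = ExtEl.unnest (s.nest.map ((Hom.toNat f).app T)) :=
  congrArg (fun α => Test.Hom.app (α.app T) y s)
    ((extFullyFaithful L R X W).map_preimage ((extComp p q).hom ≫
      Functor.whiskerRight (Hom.toNat f) q.extFunctor ≫ (extComp p' q).inv))

lemma whiskerR_g_hom : Hom.g (whiskerR f q) ≫ (p'.subst q).hom = (p.subst q).hom := by
  obtain ⟨h₁, -⟩ := extEl_eq _ _ (whiskerR_actEl f q (bareEl (𝟙 (p.comp q).B)))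
  rw [← Category.id_comp (Hom.g (whiskerR f q)), ← Category.id_comp (p.subst q).hom]
  exact (congrArg (· ≫ (p'.subst q).hom) h₁).trans (p'.substLift_hom q _ _ _)

lemma fibMap_whiskerR_g (e : Hom.g (whiskerR f q) ≫ (p'.subst q).hom = (p.subst q).hom) :
    q.fibMap (Hom.g (whiskerR f q)) e ≫ p'.substEv q = p.substEv q ≫ Hom.g f := by
  obtain ⟨h₁, -⟩ := extEl_eq _ _ (whiskerR_actEl f q (bareEl (𝟙 (p.comp q).B)))
  have h₂ := p'.fibMap_substEv_of_eq q h₁ (b' := (p.subst q).hom)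
    ((Category.assoc _ _ _).trans ((Category.id_comp _).trans e)) (by simp)
  refine (congrArg (· ≫ p'.substEv q) (q.fibMap_congr (Category.id_comp _).symm _ _)).trans
    (h₂.trans ?_)
  change _ ≫ (q.fibMap (𝟙 _) rfl ≫ _) ≫ _ = _
  rw [Category.assoc, ← Category.assoc, fibMap_fibMap]
  exact (congrArg (· ≫ _) ((q.fibMap_congr (Category.comp_id _) _ (Category.id_comp _)).trans
    (q.fibMap_id _))).trans (Category.id_comp _)

instance whiskerR_isCart [IsIso (Hom.l f)] : IsIso (Hom.l (whiskerR f q)) := by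
  obtain ⟨h₁, h₂⟩ := extEl_eq _ _ (whiskerR_actEl f q (bareEl (𝟙 (p.comp q).B)))
  have h₃ : Hom.act (whiskerR f q) (𝟙 _) ≫ 𝟙 _ =
    (p'.comp q).fibMap (𝟙 _) _ ≫ nest p' q _ _ _ ≫ Hom.act f _ ≫
      unnest p q _ _ _ ≫ 𝟙 _ := congrArg Subtype.val h₂
  have : IsIso (Hom.act (whiskerR f q) (𝟙 _)) := by
    rw [← Category.comp_id (Hom.act (whiskerR f q) (𝟙 _)), h₃]
    infer_instance
  exact Hom.isCart_of_isIso_act _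

/-- Whiskering postcomposes maps from fibres with `f.g`. If the universal evaluation lifts through
the monomorphism `f.g`, then so does every such map, uniquely; the element classified by `e` is the
inverse. -/
lemma isIso_whiskerR_g [Mono (Hom.g f)] (e : q.fib (p'.subst q).hom ⟶ p.B)
    (he : e ≫ Hom.g f = p'.substEv q) : IsIso (Hom.g (whiskerR f q)) := by
  have w := whiskerR_g_hom f q
  have h : e ≫ p.t = q.ι (p'.subst q).hom ≫ q.r := by
    rw [← substEv_t, ← he, Category.assoc, Hom.g_t]
  have hc := p.substLift_hom q _ e h
  refine ⟨p.substLift q _ e h, ?_, ?_⟩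
  · refine p.subst_ext q (b := (p.subst q).hom) (by rw [Category.assoc, hc, w])
      (Category.id_comp _) ?_
    rw [← cancel_mono (Hom.g f), ← q.fibMap_fibMap _ hc w, fibMap_id, Category.id_comp,
      Category.assoc, Category.assoc, ← Category.assoc _ (p.substEv q), p.substLift_ev q, he,
      fibMap_whiskerR_g]
  · refine p'.subst_ext q (b := (p'.subst q).hom) (by rw [Category.assoc, w, hc])
      (Category.id_comp _) ?_
    rw [← q.fibMap_fibMap _ w hc, fibMap_id, Category.id_comp, Category.assoc, fibMap_whiskerR_g,
      ← Category.assoc, p.substLift_ev q, he]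

end

end Poly

/-! ### Projections and injections attached to a morphism of `R`. -/

namespace Poly

variable {E : Type u} [Category.{v} E] [HasPullbacks E] {L R : MorphismProperty E}
  [IsProtocalibration L] [IsProtocalibration R] {X Y W : E}

/-- The polynomial `X ⟵ X ⟶ X ⟶ Y` given by a morphism `u : X ⟶ Y` of `R`. -/
abbrev inj (u : X ⟶ Y) (hu : R u) : Poly L R X Y where
  A := X
  B := X
  r := 𝟙 X
  n := 𝟙 X
  t := u
  n_mem := L.id_mem X
  t_mem := hu

/-- The polynomial `Y ⟵ X ⟶ X ⟶ X` given by a morphism `u : X ⟶ Y`. -/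
abbrev proj (u : X ⟶ Y) : Poly L R Y X where
  A := X
  B := X
  r := u
  n := 𝟙 X
  t := 𝟙 X
  n_mem := L.id_mem X
  t_mem := R.id_mem X

/-- The morphism to the identity from a polynomial whose middle component is invertible and
whose outer components agree. -/
noncomputable def toId [IsCompatible L R] (s : Poly L R X X) [IsIso s.n] (h : s.r = s.n ≫ s.t) :
    s ⟶ idPoly X :=
  Hom.ofIsPullback (q := idPoly X) (g := s.t) (k := s.r) (IsPullback.of_vert_isIso ⟨by simp [h]⟩)
    (Category.comp_id _) (Category.comp_id _)

instance [IsCompatible L R] (s : Poly L R X X) [IsIso s.n] (h : s.r = s.n ≫ s.t) :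
    IsIso (Hom.l (toId s h)) :=
  Hom.ofIsPullback_isCart _ _ _

variable [IsCompatible L R]

/-- When `p.t` is invertible, each fibre of `q.n` has exactly one map to `p.B` over `Y`, so an
element of `p.subst q` is just an element of `q.B`. -/
lemma isIso_subst_hom (p : Poly L R X Y) (q : Poly L R Y W) [IsIso p.t] :
    IsIso (p.subst q).hom := by
  have hc := p.substLift_hom q (𝟙 q.B) (q.ι _ ≫ q.r ≫ inv p.t) (by simp)
  refine ⟨p.substLift q (𝟙 q.B) (q.ι _ ≫ q.r ≫ inv p.t) (by simp), ?_, hc⟩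
  refine p.subst_ext q (b := (p.subst q).hom) (by rw [Category.assoc, hc, Category.comp_id])
    (Category.id_comp _) ?_
  rw [← cancel_mono p.t, Category.assoc (q.fibMap _ _), Category.assoc (q.fibMap _ _),
    substEv_t, fibMap_ι_assoc, fibMap_ι_assoc]

lemma r_proj_comp_inj (u : X ⟶ Y) (hu : R u) :
    ((proj u : Poly L R Y X).comp (inj u hu)).r =
      ((proj u : Poly L R Y X).comp (inj u hu)).n ≫ ((proj u : Poly L R Y X).comp (inj u hu)).t := by
  let p : Poly L R Y X := proj u
  let q : Poly L R X Y := inj u hu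
  have h₁ : p.π (p.substEv q) ≫ p.substEv q = p.ι (p.substEv q) :=
    (p.π_ι _).trans (Category.comp_id _)
  have h₂ : p.substEv q = q.ι (p.subst q).hom :=
    (Category.comp_id _).symm.trans ((p.substEv_t q).trans (Category.comp_id _))
  have h₃ : q.π (p.subst q).hom ≫ (p.subst q).hom = q.ι (p.subst q).hom :=
    (q.π_ι _).trans (Category.comp_id _)
  change p.ι (p.substEv q) ≫ u = (p.π (p.substEv q) ≫ q.π (p.subst q).hom) ≫ (p.subst q).hom ≫ u
  rw [Category.assoc, ← Category.assoc _ _ u, h₃, ← h₂, ← h₁, Category.assoc]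

/-- Here `p.t` and `q.r` are both `u`, so cancelling the monomorphism identifies the evaluation with
the projection `q.ι`. -/
lemma r_inj_comp_proj (u : X ⟶ Y) [Mono u] (hu : R u) :
    ((inj u hu : Poly L R X Y).comp (proj u)).r =
      ((inj u hu : Poly L R X Y).comp (proj u)).n ≫ ((inj u hu : Poly L R X Y).comp (proj u)).t := by
  let p : Poly L R X Y := inj u hu
  let q : Poly L R Y X := proj u
  have h₁ : p.π (p.substEv q) ≫ p.substEv q = p.ι (p.substEv q) :=
    (p.π_ι _).trans (Category.comp_id _)
  have h₂ : p.substEv q = q.ι (p.subst q).hom := (cancel_mono u).1 (p.substEv_t q)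
  have h₃ : q.π (p.subst q).hom ≫ (p.subst q).hom = q.ι (p.subst q).hom :=
    (q.π_ι _).trans (Category.comp_id _)
  change p.ι (p.substEv q) ≫ 𝟙 X =
    (p.π (p.substEv q) ≫ q.π (p.subst q).hom) ≫ (p.subst q).hom ≫ 𝟙 X
  rw [Category.assoc, ← Category.assoc _ _ (𝟙 X), h₃, ← h₂, ← h₁, Category.assoc]

instance (p : Poly L R X Y) (q : Poly L R Y W) [IsIso p.n] [IsIso q.n] : IsIso (p.comp q).n :=
  inferInstanceAs (IsIso (p.π _ ≫ q.π _))

/-- The counit of the adjunction between `inj u` and `proj u`. -/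
noncomputable def counit (u : X ⟶ Y) (hu : R u) :
    (proj u : Poly L R Y X).comp (inj u hu) ⟶ idPoly Y :=
  toId _ (r_proj_comp_inj u hu)

lemma counit_isCart (u : X ⟶ Y) (hu : R u) :
    IsIso (Hom.l (counit u hu : (proj u : Poly L R Y X).comp _ ⟶ _)) :=
  inferInstanceAs (IsIso (Hom.l (toId _ _)))

/-- The inverse of the unit of the adjunction between `inj u` and `proj u`. -/
noncomputable def unitInv (u : X ⟶ Y) [Mono u] (hu : R u) :
    (inj u hu : Poly L R X Y).comp (proj u) ⟶ idPoly X :=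
  toId _ (r_inj_comp_proj u hu)

lemma isIso_unitInv (u : X ⟶ Y) [Mono u] (hu : R u) :
    IsIso (unitInv u hu : (inj u hu : Poly L R X Y).comp (proj u) ⟶ _) := by
  let p : Poly L R X Y := inj u hu
  let q : Poly L R Y X := proj u
  have hc := p.substLift_hom q (𝟙 q.B) (q.ι _) rfl
  -- Elements of the composite are maps `β` from a fibre with `β ≫ u = q.ι _ ≫ u`; as `u` is monic,
  -- `q.ι _` is the only one.
  have : IsIso (p.subst q).hom := by
    refine ⟨p.substLift q (𝟙 q.B) (q.ι _) rfl, ?_, hc⟩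
    refine p.subst_ext q (b := (p.subst q).hom) (by rw [Category.assoc, hc, Category.comp_id])
      (Category.id_comp _) ?_
    have h₂ : p.substEv q = q.ι (p.subst q).hom := (cancel_mono u).1 (p.substEv_t q)
    rw [h₂, fibMap_ι, fibMap_ι]
  have : IsIso (Hom.l (unitInv u hu : (inj u hu : Poly L R X Y).comp (proj u) ⟶ _)) :=
    inferInstanceAs (IsIso (Hom.l (toId _ _)))
  have : IsIso (Hom.g (unitInv u hu : (inj u hu : Poly L R X Y).comp (proj u) ⟶ _)) :=
    inferInstanceAs (IsIso ((p.subst q).hom ≫ 𝟙 X))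
  exact isIso_of_isCart _

lemma isCoprod_counit {X₁ X₂ X : E}
    {i₁ : X₁ ⟶ X} {i₂ : X₂ ⟶ X} (h : IsCoprod i₁ i₂) (h₁ : R i₁) (h₂ : R i₂) :
    IsCoprod (Hom.g (counit i₁ h₁ : (proj i₁ : Poly L R X X₁).comp _ ⟶ _))
      (Hom.g (counit i₂ h₂ : (proj i₂ : Poly L R X X₂).comp _ ⟶ _)) := by
  have := isIso_subst_hom (proj i₁ : Poly L R X X₁) (inj i₁ h₁)
  have := isIso_subst_hom (proj i₂ : Poly L R X X₂) (inj i₂ h₂)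
  exact h.iso_comp ((proj i₁ : Poly L R X X₁).subst (inj i₁ h₁)).hom
    ((proj i₂ : Poly L R X X₂).subst (inj i₂ h₂)).hom rfl rfl

/-- Postcomposing with `proj i₁` makes the coprojection of a sum of polynomials over `X₁` and `X₂`
invertible. -/
lemma isIso_whiskerR_proj [HasFiniteCoproducts E] (hE : IsExtensive R)
    (hR : ClosedUnderFiniteCoproducts R) {X₁ X₂ X : E}
    {i₁ : X₁ ⟶ X} {i₂ : X₂ ⟶ X} (h : IsCoprod i₁ i₂) {p₁ p₂ p : Poly L R W X} (f₁ : p₁ ⟶ p)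
    (f₂ : p₂ ⟶ p) [IsIso (Hom.l f₁)] (hf : IsCoprod (Hom.g f₁) (Hom.g f₂)) {t₁ : p₁.B ⟶ X₁}
    {t₂ : p₂.B ⟶ X₂} (ht₁ : R t₁) (ht₂ : R t₂) (w₁ : t₁ ≫ i₁ = p₁.t) (w₂ : t₂ ≫ i₂ = p₂.t) :
    IsIso (whiskerR f₁ (proj i₁)) := by
  obtain ⟨hp, -⟩ := hE.isPullback_of_isCoprod hR h hf (a := p.t) ht₁ ht₂ (by rw [Hom.g_t, w₁])
    (by rw [Hom.g_t, w₂])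
  have := hE.mono_of_isCoprod hR hf
  -- By extensivity `p₁.B` is the pullback of `p.t` along `i₁`. The evaluation for `proj i₁` lies
  -- over `i₁`, so it lifts to `p₁.B`.
  have := isIso_whiskerR_g f₁ (proj i₁) (hp.lift _ _ (p.substEv_t _)) (hp.lift_fst _ _ _)
  exact isIso_of_isCart _

end Poly

/-! ### Finite coproducts and their preservation from binary diagrams and an initial object. -/

section

variable {C : Type*} [Category C]

lemma hasFiniteCoproducts_of_isCoprod (h₀ : ∃ X : C, Nonempty (IsInitial X))
    (h : ∀ X Y : C, ∃ (Z : C) (i : X ⟶ Z) (j : Y ⟶ Z), IsCoprod i j) : HasFiniteCoproducts C := by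
  have : HasInitial C := h₀.choose_spec.some.hasInitial
  have : ∀ {X Y : C}, HasColimit (pair X Y) := fun {X Y} => by
    obtain ⟨Z, i, j, hij⟩ := h X Y
    exact ⟨⟨⟨_, hij.nonempty_isColimit.some⟩⟩⟩
  have := hasBinaryCoproducts_of_hasColimit_pair C
  exact hasFiniteCoproducts_of_has_binary_and_initial

/-- It is enough to test one initial object and one coproduct diagram for each pair, which permits
using only the cartesian sums. -/
lemma preservesFiniteCoproducts_of_isCoprod {D : Type*} [Category D] (F : C ⥤ D)
    (h₀ : ∃ X : C, Nonempty (IsInitial X) ∧ Nonempty (IsInitial (F.obj X)))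
    (h : ∀ X Y : C, ∃ (Z : C) (i : X ⟶ Z) (j : Y ⟶ Z), IsCoprod i j ∧
      IsCoprod (F.map i) (F.map j)) : PreservesFiniteCoproducts F := by
  obtain ⟨X₀, ⟨hX₀⟩, ⟨hF⟩⟩ := h₀
  have := hasFiniteCoproducts_of_isCoprod ⟨X₀, ⟨hX₀⟩⟩ fun X Y =>
    let ⟨Z, i, j, hij, _⟩ := h X Y
    ⟨Z, i, j, hij⟩
  have h₂ : PreservesColimitsOfShape (Discrete WalkingPair) F := ⟨fun {K} => by
    have : PreservesColimit (pair (K.obj ⟨.left⟩) (K.obj ⟨.right⟩)) F := by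
      obtain ⟨Z, i, j, hij, hF⟩ := h (K.obj ⟨.left⟩) (K.obj ⟨.right⟩)
      exact preservesColimit_of_preserves_colimit_cocone hij.nonempty_isColimit.some
        ((isColimitMapCoconeBinaryCofanEquiv F i j).symm hF.nonempty_isColimit.some)
    exact preservesColimit_of_iso_diagram F (diagramIsoPair K).symm⟩
  have : PreservesColimit (Functor.empty.{0} C) F :=
    preservesColimit_of_preserves_colimit_cocone hX₀
      ((isColimitMapCoconeEmptyCoconeEquiv F X₀).symm hF)
  have := preservesColimitsOfShape_pempty_of_preservesInitial F
  exact ⟨fun n => PreservesFiniteCoproducts.of_preserves_binary_and_initial F (Fin n)⟩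

end

/-! ### Recognising bicategorical products. -/

section

open Bicategory

variable {B : Type*} [Bicategory B] {X₁ X₂ P : B} (π₁ : P ⟶ X₁) (π₂ : P ⟶ X₂) (ι₁ : X₁ ⟶ P)
  (ι₂ : X₂ ⟶ P)

/-- A recognition principle for bicategorical products that are sums of sections of the
projections. -/
lemma isBicategoricalProduct_of_isCoprod (η₁ : ι₁ ≫ π₁ ≅ 𝟙 X₁) (η₂ : ι₂ ≫ π₂ ≅ 𝟙 X₂)
    (ε₁ : π₁ ≫ ι₁ ⟶ 𝟙 P) (ε₂ : π₂ ≫ ι₂ ⟶ 𝟙 P)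
    (hε : ∀ {W : B} (p : W ⟶ P), IsCoprod (p ◁ ε₁) (p ◁ ε₂))
    (hs : ∀ {W : B} (p₁ : W ⟶ X₁) (p₂ : W ⟶ X₂), ∃ (s : W ⟶ P) (f₁ : p₁ ≫ ι₁ ⟶ s)
      (f₂ : p₂ ≫ ι₂ ⟶ s), IsCoprod f₁ f₂ ∧ IsIso (f₁ ▷ π₁) ∧ IsIso (f₂ ▷ π₂)) :
    IsBicategoricalProduct π₁ π₂ := by
  intro W
  choose s f₁ f₂ hf hf₁ hf₂ using fun p : (W ⟶ X₁) × (W ⟶ X₂) => hs p.1 p.2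
  let Φ := (postcomp W π₁).prod' (postcomp W π₂)
  -- The quasi-inverse sends a pair to its chosen sum in `W ⟶ P`; uniqueness of copairings makes it
  -- functorial.
  let Ψ : (W ⟶ X₁) × (W ⟶ X₂) ⥤ (W ⟶ P) :=
    { obj := s
      map := fun {p q} k => (hf p).desc (k.1 ▷ ι₁ ≫ f₁ q) (k.2 ▷ ι₂ ≫ f₂ q)
      map_id := fun p => (hf p).hom_ext (by simp) (by simp)
      map_comp := fun {p q r} k l => (hf p).hom_ext (by simp) (by simp) }
  let e₁ : ∀ p : W ⟶ P, (p ≫ π₁) ≫ ι₁ ⟶ p := fun p => (α_ p π₁ ι₁).hom ≫ p ◁ ε₁ ≫ (ρ_ p).hom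
  let e₂ : ∀ p : W ⟶ P, (p ≫ π₂) ≫ ι₂ ⟶ p := fun p => (α_ p π₂ ι₂).hom ≫ p ◁ ε₂ ≫ (ρ_ p).hom
  have he : ∀ p, IsCoprod (e₁ p) (e₂ p) := fun p =>
    ((hε p).iso_comp (α_ p π₁ ι₁).hom (α_ p π₂ ι₂).hom rfl rfl).comp_iso (ρ_ p).hom
      (by simp [e₁]) (by simp [e₂])
  have nat₁ : ∀ {p q : W ⟶ P} (k : p ⟶ q), (k ▷ π₁) ▷ ι₁ ≫ e₁ q = e₁ p ≫ k := fun k => by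
    simp only [e₁, Category.assoc]
    rw [associator_naturality_left_assoc, ← whisker_exchange_assoc, rightUnitor_naturality]
  have nat₂ : ∀ {p q : W ⟶ P} (k : p ⟶ q), (k ▷ π₂) ▷ ι₂ ≫ e₂ q = e₂ p ≫ k := fun k => by
    simp only [e₂, Category.assoc]
    rw [associator_naturality_left_assoc, ← whisker_exchange_assoc, rightUnitor_naturality]
  -- Both `p` and the chosen sum of its reinserted projections are coproducts of the same two
  -- 1-cells.
  have hθ := fun p : W ⟶ P => (hf (p ≫ π₁, p ≫ π₂)).isIso_desc (he p)
  let θ : Φ ⋙ Ψ ≅ 𝟭 (W ⟶ P) :=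
    NatIso.ofComponents (fun p => @asIso _ _ _ _ _ (hθ p)) (fun {p q} k =>
      (hf (p ≫ π₁, p ≫ π₂)).hom_ext
        (((hf (p ≫ π₁, p ≫ π₂)).inl_desc_assoc _ _ _).trans ((Category.assoc _ _ _).trans
          ((congrArg (_ ≫ ·) (IsCoprod.inl_desc _ _ _)).trans ((nat₁ k).trans
            ((hf (p ≫ π₁, p ≫ π₂)).inl_desc_assoc _ _ _).symm))))
        (((hf (p ≫ π₁, p ≫ π₂)).inr_desc_assoc _ _ _).trans ((Category.assoc _ _ _).trans
          ((congrArg (_ ≫ ·) (IsCoprod.inr_desc _ _ _)).trans ((nat₂ k).trans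
            ((hf (p ≫ π₁, p ≫ π₂)).inr_desc_assoc _ _ _).symm)))))
  -- The section isomorphism gives `p.1 ≅ (p.1 ≫ ι₁) ≫ π₁`, and `f₁ ▷ π₁` identifies the latter with
  -- the projected sum.
  let κ₁ : ∀ p : (W ⟶ X₁) × (W ⟶ X₂), p.1 ≅ s p ≫ π₁ := fun p =>
    (ρ_ p.1).symm ≪≫ whiskerLeftIso p.1 η₁.symm ≪≫ (α_ p.1 ι₁ π₁).symm ≪≫ asIso (f₁ p ▷ π₁)
  let κ₂ : ∀ p : (W ⟶ X₁) × (W ⟶ X₂), p.2 ≅ s p ≫ π₂ := fun p =>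
    (ρ_ p.2).symm ≪≫ whiskerLeftIso p.2 η₂.symm ≪≫ (α_ p.2 ι₂ π₂).symm ≪≫ asIso (f₂ p ▷ π₂)
  have natκ₁ : ∀ {p q : (W ⟶ X₁) × (W ⟶ X₂)} (k : p ⟶ q),
      k.1 ≫ (κ₁ q).hom = (κ₁ p).hom ≫ Ψ.map k ▷ π₁ := fun {p q} k => by
    have h : f₁ p ▷ π₁ ≫ Ψ.map k ▷ π₁ = (k.1 ▷ ι₁) ▷ π₁ ≫ f₁ q ▷ π₁ := by
      rw [← comp_whiskerRight, ← comp_whiskerRight]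
      exact congrArg (· ▷ π₁) ((hf p).inl_desc _ _)
    simp only [κ₁, Iso.trans_hom, Iso.symm_hom, whiskerLeftIso_hom, asIso_hom, Category.assoc, h]
    rw [rightUnitor_inv_naturality_assoc, ← whisker_exchange_assoc,
      associator_inv_naturality_left_assoc]
  have natκ₂ : ∀ {p q : (W ⟶ X₁) × (W ⟶ X₂)} (k : p ⟶ q),
      k.2 ≫ (κ₂ q).hom = (κ₂ p).hom ≫ Ψ.map k ▷ π₂ := fun {p q} k => by
    have h : f₂ p ▷ π₂ ≫ Ψ.map k ▷ π₂ = (k.2 ▷ ι₂) ▷ π₂ ≫ f₂ q ▷ π₂ := by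
      rw [← comp_whiskerRight, ← comp_whiskerRight]
      exact congrArg (· ▷ π₂) ((hf p).inr_desc _ _)
    simp only [κ₂, Iso.trans_hom, Iso.symm_hom, whiskerLeftIso_hom, asIso_hom, Category.assoc, h]
    rw [rightUnitor_inv_naturality_assoc, ← whisker_exchange_assoc,
      associator_inv_naturality_left_assoc]
  let κ : 𝟭 _ ≅ Ψ ⋙ Φ := NatIso.ofComponents (fun p => Iso.prod (κ₁ p) (κ₂ p)) (fun k =>
    Prod.ext (natκ₁ k) (natκ₂ k))
  -- No triangle identity relating `η` and `ε` is needed: two natural isomorphisms suffice for an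
  -- equivalence.
  exact (CategoryTheory.Equivalence.mk Φ Ψ θ.symm κ.symm).isEquivalence_functor

end

/-! ### The bicategory of polynomials: the theorem's assertions. -/

section

open Bicategory

variable {E : Type u} [Category.{v} E] [HasPullbacks E] [HasFiniteCoproducts E]
  {L R : MorphismProperty E} [IsProtocalibration L] [IsProtocalibration R] [IsCompatible L R]

namespace Ply

lemma isCoprod_whiskerLeft (hE : IsExtensive R) (hR : ClosedUnderFiniteCoproducts R)
    {X Y Z : Ply L R} (q : Z ⟶ X) {p₁ p₂ p : X ⟶ Y} (f₁ : p₁ ⟶ p) (f₂ : p₂ ⟶ p)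
    (h₁ : IsIso (Poly.Hom.l f₁)) (h₂ : IsIso (Poly.Hom.l f₂))
    (h : IsCoprod (Poly.Hom.g f₁) (Poly.Hom.g f₂)) : IsCoprod (q ◁ f₁) (q ◁ f₂) :=
  Poly.isCoprod_of_isCart hE hR (Poly.whiskerL q f₁) (Poly.whiskerL q f₂)
    (hE.isCoprod_of_isPullback hR h
      (IsCompatible.pushforward_mem (L := L) _ p.n_mem _ (R.pullback_snd _ _ q.t_mem))
      (Poly.isPullback_whiskerL_g q f₁) (Poly.isPullback_whiskerL_g q f₂))

lemma nonempty_isInitial_comp (hE : IsExtensive R) {X Y Z : Ply L R} (q : Z ⟶ X) (p : X ⟶ Y)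
    (hp : IsInitial p.B) : Nonempty (IsInitial (q ≫ p)) := by
  have := hE.isIso_of_isInitial hp (Poly.subst q p).hom
    (IsCompatible.pushforward_mem (L := L) _ p.n_mem _ (R.pullback_snd _ _ q.t_mem))
  exact Poly.nonempty_isInitial hE (Poly.comp q p) (hp.ofIso (asIso (Poly.subst q p).hom).symm)

lemma hasFiniteCoproducts_hom (hE : IsExtensive R) (hL : ClosedUnderFiniteCoproducts L)
    (hR : ClosedUnderFiniteCoproducts R) (X Y : Ply L R) : HasFiniteCoproducts (X ⟶ Y) := by
  refine hasFiniteCoproducts_of_isCoprod ?_ fun p₁ p₂ => ?_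
  · obtain ⟨p, ⟨hp⟩⟩ := Poly.exists_isInitial (L := L) (X := X.obj) (Y := Y.obj) hR
    exact ⟨p, Poly.nonempty_isInitial hE p hp⟩
  · obtain ⟨p, f₁, f₂, _, _, h⟩ := Poly.exists_isCart_isCoprod hE hL hR p₁ p₂
    exact ⟨p, f₁, f₂, Poly.isCoprod_of_isCart hE hR f₁ f₂ h⟩

lemma preservesFiniteCoproducts_precomp (hE : IsExtensive R) (hL : ClosedUnderFiniteCoproducts L)
    (hR : ClosedUnderFiniteCoproducts R) (X Y Z : Ply L R) (q : Z ⟶ X) :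
    PreservesFiniteCoproducts (precomp Y q) := by
  refine preservesFiniteCoproducts_of_isCoprod _ ?_ fun p₁ p₂ => ?_
  · obtain ⟨p, ⟨hp⟩⟩ := Poly.exists_isInitial (L := L) (X := X.obj) (Y := Y.obj) hR
    exact ⟨p, Poly.nonempty_isInitial hE p hp, nonempty_isInitial_comp hE q p hp⟩
  · obtain ⟨p, f₁, f₂, h₁, h₂, h⟩ := Poly.exists_isCart_isCoprod hE hL hR p₁ p₂
    exact ⟨p, f₁, f₂, Poly.isCoprod_of_isCart hE hR f₁ f₂ h,
      isCoprod_whiskerLeft hE hR q f₁ f₂ h₁ h₂ h⟩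

lemma isBiterminal (hE : IsExtensive R) (hR : ClosedUnderFiniteCoproducts R) :
    IsBiterminal (⟨⊥_ E⟩ : Ply L R) := by
  intro W
  -- Since `p.t` is in `R` and ends at the initial object, `p.B` is initial; every object of this
  -- hom-category is therefore initial.
  have h : ∀ p : W ⟶ (⟨⊥_ E⟩ : Ply L R), Nonempty (IsInitial p) := fun p => by
    have := hE.isIso_of_isInitial initialIsInitial p.t p.t_mem
    exact Poly.nonempty_isInitial hE p (initialIsInitial.ofIso (asIso p.t).symm)
  obtain ⟨p, -⟩ := Poly.exists_isInitial (L := L) (X := W.obj) (Y := ⊥_ E) hR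
  let F := (Functor.star (W ⟶ (⟨⊥_ E⟩ : Ply L R)) : _ ⥤ Discrete PUnit.{1})
  have : F.Faithful := ⟨fun {p q} _ _ _ => (h p).some.hom_ext _ _⟩
  have : F.Full := ⟨fun {p q} _ => ⟨(h p).some.to q, Subsingleton.elim _ _⟩⟩
  have : F.EssSurj := ⟨fun _ => ⟨p, ⟨eqToIso (Subsingleton.elim _ _)⟩⟩⟩
  exact {}

lemma exists_isBicategoricalProduct (hE : IsExtensive R) (hL : ClosedUnderFiniteCoproducts L)
    (hR : ClosedUnderFiniteCoproducts R) (X Y : Ply L R) :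
    ∃ (P : Ply L R) (π₁ : P ⟶ X) (π₂ : P ⟶ Y), IsBicategoricalProduct π₁ π₂ := by
  have h := IsCoprod.coprod X.obj Y.obj
  have h₁ := hR.inl X.obj Y.obj
  have h₂ := hR.inr X.obj Y.obj
  have := hE.mono_of_isCoprod hR h
  have := hE.mono_of_isCoprod hR h.symm
  refine ⟨⟨X.obj ⨿ Y.obj⟩, Poly.proj coprod.inl, Poly.proj coprod.inr,
    isBicategoricalProduct_of_isCoprod _ _ (Poly.inj coprod.inl h₁) (Poly.inj coprod.inr h₂)
      (@asIso _ _ _ _ _ (Poly.isIso_unitInv coprod.inl h₁))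
      (@asIso _ _ _ _ _ (Poly.isIso_unitInv coprod.inr h₂))
      (Poly.counit coprod.inl h₁) (Poly.counit coprod.inr h₂)
      (fun p => isCoprod_whiskerLeft hE hR p _ _ (Poly.counit_isCart _ h₁)
        (Poly.counit_isCart _ h₂) (Poly.isCoprod_counit h h₁ h₂)) fun {W} p₁ p₂ => ?_⟩
  obtain ⟨s, f₁, f₂, _, _, hf⟩ := Poly.exists_isCart_isCoprod hE hL hR
    (Poly.comp p₁ (Poly.inj coprod.inl h₁)) (Poly.comp p₂ (Poly.inj coprod.inr h₂))
  -- The last leg of `p₁` followed by the injection is by definition this morphism followed by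
  -- `coprod.inl`. It serves as `t₁` in `Poly.isIso_whiskerR_proj`.
  have ht₁ : R (Poly.subst p₁ (Poly.inj coprod.inl h₁)).hom :=
    IsCompatible.pushforward_mem (L := L) _ (L.id_mem _) _ (R.pullback_snd _ _ p₁.t_mem)
  have ht₂ : R (Poly.subst p₂ (Poly.inj coprod.inr h₂)).hom :=
    IsCompatible.pushforward_mem (L := L) _ (L.id_mem _) _ (R.pullback_snd _ _ p₂.t_mem)
  exact ⟨s, f₁, f₂, Poly.isCoprod_of_isCart hE hR f₁ f₂ hf,
    Poly.isIso_whiskerR_proj hE hR h f₁ f₂ hf ht₁ ht₂ rfl rfl,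
    Poly.isIso_whiskerR_proj hE hR h.symm f₂ f₁ hf.symm ht₂ ht₁ rfl rfl⟩

end Ply

end

end PolyBicat

theorem theorem6 {E : Type u} [Category.{v} E] [HasPullbacks E] [HasFiniteCoproducts E]
    (L R : MorphismProperty E) [IsProtocalibration L] [IsProtocalibration R] [IsCompatible L R]
    (hE : IsExtensive R) (hL : ClosedUnderFiniteCoproducts L)
    (hR : ClosedUnderFiniteCoproducts R) :
    HasFiniteBicategoricalProducts (Ply L R) ∧
    (∀ X Y : Ply L R, HasFiniteCoproducts (X ⟶ Y)) ∧
    (∀ (X Y Z : Ply L R) (q : Z ⟶ X), PreservesFiniteCoproducts (Bicategory.precomp Y q)) :=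
  ⟨⟨⟨_, Ply.isBiterminal hE hR⟩, Ply.exists_isBicategoricalProduct hE hL hR⟩,
    Ply.hasFiniteCoproducts_hom hE hL hR, Ply.preservesFiniteCoproducts_precomp hE hL hR⟩
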